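/- Let $g\ge 1$, $r+s=g$ with $r,s\ge 0$, $\Delta$ a positive integer, $K=\mathbb{Q}(\sqrt{-\Delta})$, and $p\neq 2$ a prime that is inert in $K$ in the sense that $\left(\frac{-\Delta}{p}\right)=-1$. Let $E=\mathrm{diag}(1,\dots,1,-1,\dots,-1)$ ($r$ ones, $s$ minus ones). *The varieties.* Let $G=\mathrm{GSp}_{2g}$ and let $\mathcal K\subset G(\mathbb A_f)$ be a compact open subgroup of level prime to $p$ (the product of $G(\mathbb Z_p)$ and a group of adeles that are trivial at $p$). Let $X=[\mathcal D\times\mathcal K\backslash G(\mathbb A_f)]/G(\mathbb Q)$ be the Siegel variety of genus $g$ and level $\mathcal K$, $\mathcal D$ being the union of the Siegel upper and lower half spaces. The group $G_V=GU(r,s)$ of the matrices $\mathfrak g=h+k\sqrt{-\Delta}$ with $\mathfrak gE\bar{\mathfrak g}^t=\lambda E$, $\lambda$ invertible, is embedded in $G$ by $$\alpha(\mathfrak g)=\begin{pmatrix}h&kE\\-\Delta Ek&EhE\end{pmatrix};$$ let $\mathcal D_V\subset\mathcal D$ be its symmetric domain, $V\subset X$ the corresponding Shimura subvariety, and $V_c=\{[x,1]:x\in\mathcal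 D_V\}$. *The Hecke correspondence.* Let $\tau_p=\mathrm{diag}(1,\dots,1,p,\dots,p)\in G(\mathbb Q_p)$ ($g$ ones), regarded as an adele that is trivial outside $p$, let $\mathcal K_p=\mathcal K\cap\tau_p^{-1}\mathcal K\tau_p$, and let $X_p=[\mathcal D\times\mathcal K_p\backslash G(\mathbb A_f)]/G(\mathbb Q)$. The correspondence $T_p$ is given by the projections $\pi_1[x,a]=[x,a]$, $\pi_2[x,a]=[x,\tau_pa]$ from $X_p$ to $X$. Each $\sigma\in G(\mathbb Z_p)\tau_pG(\mathbb Z_p)$ satisfies $\mathcal K\sigma=\mathcal K\tau_pc$ for some $c\in\mathcal K$, unique up to left multiplication by $\mathcal K_p$. It determines the component $\{[x,c]:x\in\mathcal D_V\}$ of $\pi_1^{-1}(V_c)$ and the Shimura subvariety $\{[x,cu]:x\in\mathcal D_V,\ u\in\alpha(G_V(\mathbb A_f))\}$ of $X_p$. Two such elements $\sigma_1,\sigma_2$ are called D-equivalent if some $\sigma\in G(\mathbb Z_p)\tau_pG(\mathbb Z_p)$ has the property that its Shimura subvariety contains the components determined by $\sigma_1$ and by $\sigma_2$. *The generic stratum.*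 The open part consists of the elements $\sigma=\begin{pmatrix}E_g&S\\0&pE_g\end{pmatrix}$, with $S$ a symmetric integral $g\times g$ matrix and $E_g$ the unit matrix. For such $\sigma$ put $T(\sigma)=E+\Delta SES$, let $T(\tilde\sigma)$ be its reduction modulo $p$, and let $W_\sigma\subset\mathbb F_p^{2g}$ be the row space of $\sigma$ modulo $p$. The space $\mathbb F_p^{2g}$ of row vectors is an $\mathbb F_{p^2}$-vector space, $\sqrt{-\Delta}$ acting by right multiplication by $\alpha(\sqrt{-\Delta})$. Let $\mathfrak D_{2g}$ be the set of the $\sigma$ in the open part with $\dim_{\mathbb F_p}(\mathbb F_{p^2}W_\sigma)=2g$. **Theorem.** An element $\sigma$ of the open part lies in $\mathfrak D_{2g}$ if and only if $T(\tilde\sigma)$ is invertible. Moreover, for elements of the open part: 1. If $g$ is odd, then $\mathfrak D_{2g}$ is a single D-equivalence class: it is nonempty, and an element is D-equivalent to a given element of $\mathfrak D_{2g}$ if and only if it lies in $\mathfrak D_{2g}$. 2. If $g$ is even, then $\sigma_1,\sigma_2\in\mathfrak D_{2g}$ are D-equivalent if and only if $\det T(\tilde\sigma_1)/\det T(\tilde\sigma_2)$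 is a square in $\mathbb F_p^*$, and there are two elements of $\mathfrak D_{2g}$ that are not D-equivalent. 3. For every $g$, no element of $\mathfrak D_{2g}$ is D-equivalent to an element outside $\mathfrak D_{2g}$. -/

import Mathlib

open Matrix
open scoped RestrictedProduct

noncomputable section

namespace SiegelHecke

/-! ## The group of symplectic similitudes -/

/-- `GSp_{2g}(R)`: invertible `2g × 2g` matrices `M` with `M J Mᵗ = c J`, `c ∈ Rˣ`. -/
def GSp (g : ℕ) (R : Type*) [CommRing R] : Subgroup (GL (Fin g ⊕ Fin g) R) where
  carrier := {M | ∃ c : Rˣ, M.1 * J (Fin g) R * M.1ᵀ = (c : R) • J (Fin g) R}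
  one_mem' := ⟨1, by simp⟩
  mul_mem' := by
    rintro A B ⟨c, hc⟩ ⟨d, hd⟩
    refine ⟨c * d, ?_⟩
    have : (A * B).1 * J (Fin g) R * (A * B).1ᵀ
        = A.1 * (B.1 * J (Fin g) R * B.1ᵀ) * A.1ᵀ := by
      simp [Matrix.mul_assoc, Matrix.transpose_mul]
    rw [this, hd]
    simp only [Matrix.mul_smul, Matrix.smul_mul, hc, smul_smul, Units.val_mul]
    rw [mul_comm]
  inv_mem' := by
    rintro A ⟨c, hc⟩
    refine ⟨c⁻¹, ?_⟩
    have h1 : (A⁻¹).1 * A.1 = 1 := by rw [← Units.val_mul]; simp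
    have h2 : A.1ᵀ * (A⁻¹).1ᵀ = 1 := by rw [← Matrix.transpose_mul, h1, Matrix.transpose_one]
    have h3 : J (Fin g) R = (c : R) • ((A⁻¹).1 * J (Fin g) R * (A⁻¹).1ᵀ) := by
      calc J (Fin g) R = ((A⁻¹).1 * A.1) * J (Fin g) R * (A.1ᵀ * (A⁻¹).1ᵀ) := by
            rw [h1, h2, Matrix.one_mul, Matrix.mul_one]
        _ = (A⁻¹).1 * (A.1 * J (Fin g) R * A.1ᵀ) * (A⁻¹).1ᵀ := by
            simp only [Matrix.mul_assoc]
        _ = _ := by rw [hc]; simp only [Matrix.mul_smul, Matrix.smul_mul]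
    conv_rhs => rw [h3]
    rw [smul_smul, Units.inv_mul, one_smul]

/-- Functoriality of `GSp_{2g}` in the coefficient ring. -/
def GSp.map {g : ℕ} {R S : Type*} [CommRing R] [CommRing S] (f : R →+* S) :
    GSp g R →* GSp g S :=
  ((GeneralLinearGroup.map f).comp (GSp g R).subtype).codRestrict (GSp g S) <| by
    rintro ⟨M, c, hc⟩
    refine ⟨Units.map (f : R →* S) c, ?_⟩
    have h := congrArg (fun X => X.map f) hc
    simp only [Matrix.map_mul, map_J] at h
    have hs : ((c : R) • J (Fin g) R).map f = f c • J (Fin g) S := by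
      rw [← map_J (R := R) (l := Fin g) f]
      ext i j
      simp only [Matrix.map_apply, Matrix.smul_apply, smul_eq_mul, map_mul]
    rw [hs] at h
    exact h

/-! ## Finite adeles -/

instance factPrimes (l : Nat.Primes) : Fact (l : ℕ).Prime := ⟨l.2⟩

/-- `GSp_{2g}(ℤ_l)` as a subgroup of `GSp_{2g}(ℚ_l)`. -/
def GSpInt (g : ℕ) (l : Nat.Primes) : Subgroup (GSp g ℚ_[l]) :=
  (GSp.map (algebraMap ℤ_[l] ℚ_[l])).range

/-- `GSp_{2g}(𝔸_f)`: the restricted product of the groups `GSp_{2g}(ℚ_l)` with respect to the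
subgroups `GSp_{2g}(ℤ_l)`, with its restricted product topology. -/
abbrev GSpAf (g : ℕ) : Type := Πʳ l : Nat.Primes, [GSp g ℚ_[l], GSpInt g l]

open Classical in
/-- The inclusion `GSp_{2g}(ℚ_p) → GSp_{2g}(𝔸_f)` at the place `p`. -/
def atPlace {g : ℕ} (p : Nat.Primes) (x : GSp g ℚ_[p]) : GSpAf g :=
  RestrictedProduct.mulSingle (GSpInt g) p x

/-- The level group `𝒦` is of level prime to `p`: it is the product of `GSp_{2g}(ℤ_p)` and
a group of adeles that are trivial at `p`. -/
def LevelPrimeTo {g : ℕ} (𝒦 : Subgroup (GSpAf g)) (p : Nat.Primes) : Prop :=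
  (∀ a ∈ 𝒦, a p ∈ GSpInt g p) ∧ ∀ x ∈ GSpInt g p, atPlace p x ∈ 𝒦

/-! ## The unitary group and its inclusion in the symplectic group -/

/-- The diagonal matrix `E_{r,s}` with `r` entries `1` followed by `s = g - r` entries `-1`. -/
def signMat (g r : ℕ) (R : Type*) [CommRing R] : Matrix (Fin g) (Fin g) R :=
  Matrix.diagonal fun i => if (i : ℕ) < r then 1 else -1

/-- The matrix `α(h + k√-Δ)`. -/
def alphaMat {g : ℕ} (r Δ : ℕ) {R : Type*} [CommRing R] (h k : Matrix (Fin g) (Fin g) R) :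
    Matrix (Fin g ⊕ Fin g) (Fin g ⊕ Fin g) R :=
  fromBlocks h (k * signMat g r R) (-((Δ : R) • (signMat g r R * k)))
    (signMat g r R * h * signMat g r R)

/-- `h + k√-Δ` lies in `GU(r,s)(R)`: one has `𝔤 E 𝔤̄ᵗ = c E` with `c ∈ Rˣ`, written out in
terms of `h` and `k`. -/
def IsGU {g : ℕ} (r Δ : ℕ) {R : Type*} [CommRing R] (h k : Matrix (Fin g) (Fin g) R) : Prop :=
  (∃ c : Rˣ, h * signMat g r R * hᵀ + (Δ : R) • (k * signMat g r R * kᵀ)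
    = (c : R) • signMat g r R) ∧
  k * signMat g r R * hᵀ = h * signMat g r R * kᵀ

/-- `α(GU(r,s)(R))` as a subset of `GSp_{2g}(R)`. -/
def GUimage (g r Δ : ℕ) (R : Type*) [CommRing R] : Set (GSp g R) :=
  {M | ∃ h k : Matrix (Fin g) (Fin g) R, IsGU r Δ h k ∧ M.1.1 = alphaMat r Δ h k}

/-- `α(GU(r,s)(𝔸_f))` as a subset of `GSp_{2g}(𝔸_f)`. -/
def GUAf (g r Δ : ℕ) : Set (GSpAf g) :=
  {u | ∀ l : Nat.Primes, u l ∈ GUimage g r Δ ℚ_[l]}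

/-! ## The symmetric domains

A homomorphism `h : Res_{ℂ/ℝ} G_m → G_ℝ` of the type considered here has the form
`x + iy ↦ x + y h(i)`, so that it is given by the matrix `h(i)`, and the conjugacy class of `h`
by that of `h(i)`. -/

/-- The symmetric domain `𝒟` of the Siegel variety: the `GSp_{2g}(ℝ)`-conjugacy class of
the standard homomorphism `x + iy ↦ (x, y; -y, x)` (the union of the Siegel upper and lower half
spaces). -/
def siegelDomain (g : ℕ) : Set (Matrix (Fin g ⊕ Fin g) (Fin g ⊕ Fin g) ℝ) :=
  {x | ∃ M : GSp g ℝ, x = M.1.1 * fromBlocks 0 1 (-1) 0 * (M⁻¹).1.1}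

/-- The symmetric domain `𝒟_V` of `GU(r,s)`: the conjugacy class of the standard homomorphism
`h_V`, for which `h_V(i) = diag(i, …, i, -i, …, -i) = E_{r,s} √-Δ / √Δ`. -/
def unitaryDomain (g r Δ : ℕ) : Set (Matrix (Fin g ⊕ Fin g) (Fin g ⊕ Fin g) ℝ) :=
  {x | ∃ M ∈ GUimage g r Δ ℝ,
    x = M.1.1 * alphaMat r Δ 0 ((√(Δ : ℝ))⁻¹ • signMat g r ℝ) * (M⁻¹).1.1}

/-! ## The elements `σ(s)` -/

/-- The integral matrix `(E_g, s; 0, p E_g)`. -/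
def sigmaMat {g : ℕ} (p : ℕ) (S : Matrix (Fin g) (Fin g) ℤ) :
    Matrix (Fin g ⊕ Fin g) (Fin g ⊕ Fin g) ℤ :=
  fromBlocks 1 S 0 ((p : ℤ) • (1 : Matrix (Fin g) (Fin g) ℤ))

/-- `σ(s) = (E_g, s; 0, p E_g)`, for a symmetric integral matrix `s`, as an element of
`GSp_{2g}(ℚ_p)`. The elements `σ(s)` are the elements of the open part of `S(g)`. -/
def sigma {g : ℕ} (p : Nat.Primes) (S : Matrix (Fin g) (Fin g) ℤ) (hS : S.IsSymm) :
    GSp g ℚ_[p] where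
  val :=
    { val := (sigmaMat (p : ℕ) S).map (Int.cast : ℤ → ℚ_[p])
      inv := fromBlocks 1 (-(((p : ℕ) : ℚ_[p])⁻¹ • S.map (Int.cast : ℤ → ℚ_[p]))) 0
        (((p : ℕ) : ℚ_[p])⁻¹ • 1)
      val_inv := by
        have hp : ((p : ℕ) : ℚ_[p]) ≠ 0 := by exact_mod_cast p.2.ne_zero
        have e : ((((p : ℕ) : ℤ) • (1 : Matrix (Fin g) (Fin g) ℤ)).map (Int.cast : ℤ → ℚ_[p]))
            = ((p : ℕ) : ℚ_[p]) • 1 := by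
          ext i j
          rw [Matrix.map_apply, Matrix.smul_apply, Matrix.smul_apply, Matrix.one_apply,
            Matrix.one_apply]
          split_ifs <;> simp
        rw [sigmaMat, fromBlocks_map, e, fromBlocks_multiply]
        simp [smul_smul, hp]
      inv_val := by
        have hp : ((p : ℕ) : ℚ_[p]) ≠ 0 := by exact_mod_cast p.2.ne_zero
        have e : ((((p : ℕ) : ℤ) • (1 : Matrix (Fin g) (Fin g) ℤ)).map (Int.cast : ℤ → ℚ_[p]))
            = ((p : ℕ) : ℚ_[p]) • 1 := by
          ext i j
          rw [Matrix.map_apply, Matrix.smul_apply, Matrix.smul_apply, Matrix.one_apply,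
            Matrix.one_apply]
          split_ifs <;> simp
        rw [sigmaMat, fromBlocks_map, e, fromBlocks_multiply]
        simp [smul_smul, hp] }
  property := by
    have hp : ((p : ℕ) : ℚ_[p]) ≠ 0 := by exact_mod_cast p.2.ne_zero
    refine ⟨Units.mk0 _ hp, ?_⟩
    have e : ((((p : ℕ) : ℤ) • (1 : Matrix (Fin g) (Fin g) ℤ)).map (Int.cast : ℤ → ℚ_[p]))
        = ((p : ℕ) : ℚ_[p]) • 1 := by
      ext i j
      rw [Matrix.map_apply, Matrix.smul_apply, Matrix.smul_apply, Matrix.one_apply,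
        Matrix.one_apply]
      split_ifs <;> simp
    have hT : (S.map (Int.cast : ℤ → ℚ_[p]))ᵀ = S.map (Int.cast : ℤ → ℚ_[p]) := by
      rw [← Matrix.transpose_map, hS.eq]
    change (sigmaMat (p : ℕ) S).map (Int.cast : ℤ → ℚ_[p]) * J (Fin g) ℚ_[p]
      * ((sigmaMat (p : ℕ) S).map (Int.cast : ℤ → ℚ_[p]))ᵀ = _
    rw [sigmaMat, fromBlocks_map, e, fromBlocks_transpose, J, fromBlocks_multiply,
      fromBlocks_multiply, hT]
    simp [fromBlocks_smul]

/-- `τ_p = diag(1, …, 1, p, …, p)`, the matrix that defines the Hecke correspondence `T_p`. -/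
def tau (g : ℕ) (p : Nat.Primes) : GSp g ℚ_[p] := sigma p 0 Matrix.isSymm_zero

/-! ## The Hecke correspondence `T_p` and the subvarieties of `T_p(V)` -/

/-- The level group of the Hecke correspondence, `𝒦_p = 𝒦 ∩ τ_p⁻¹ 𝒦 τ_p`. The map
`𝒦_p c ↦ 𝒦 τ_p c` is a bijection from `𝒦_p \ 𝒦` to the set `S(g)` of the cosets `𝒦 σ` in
`𝒦 τ_p 𝒦`. -/
def levelP {g : ℕ} (𝒦 : Subgroup (GSpAf g)) (p : Nat.Primes) : Subgroup (GSpAf g) :=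
  𝒦 ⊓ 𝒦.comap (MulAut.conj (atPlace p (tau g p))).toMonoidHom

/-- Two elements of `𝒟 × GSp_{2g}(𝔸_f)` define the same point of
`[𝒟 × 𝒦 \ GSp_{2g}(𝔸_f)] / GSp_{2g}(ℚ)`, where `γ ∈ GSp_{2g}(ℚ)` acts on the right by
`(x, a) ↦ (γ⁻¹xγ, aγ)`. -/
def shimuraSetoid {g : ℕ} (𝒦 : Subgroup (GSpAf g)) : Setoid (siegelDomain g × GSpAf g) where
  r P Q := ∃ γ : GSp g ℚ, ∃ k ∈ 𝒦,
    (Q.1 : Matrix _ _ ℝ) = (GSp.map (algebraMap ℚ ℝ) γ⁻¹).1.1 * P.1.1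
      * (GSp.map (algebraMap ℚ ℝ) γ).1.1 ∧
    ∀ l : Nat.Primes, Q.2 l = k l * P.2 l * GSp.map (algebraMap ℚ ℚ_[l]) γ
  iseqv := by
    have inv1 : ∀ x : GSp g ℝ, x.1.1 * (x⁻¹).1.1 = 1 := fun x => by
      rw [← Units.val_mul, ← Subgroup.coe_mul, mul_inv_cancel]; rfl
    refine ⟨fun P => ⟨1, 1, 𝒦.one_mem, by simp, by simp⟩, ?_, ?_⟩
    · rintro P Q ⟨γ, k, hk, h1, h2⟩
      refine ⟨γ⁻¹, k⁻¹, 𝒦.inv_mem hk, ?_, fun l => ?_⟩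
      · rw [h1, inv_inv, map_inv]
        have := inv1 (GSp.map (algebraMap ℚ ℝ) γ)
        simp only [← Matrix.mul_assoc, this, Matrix.one_mul]
        rw [Matrix.mul_assoc, this, Matrix.mul_one]
      · rw [h2 l, map_inv, RestrictedProduct.inv_apply]
        group
    · rintro P Q R ⟨γ, k, hk, h1, h2⟩ ⟨δ, m, hm, h3, h4⟩
      refine ⟨γ * δ, m * k, 𝒦.mul_mem hm hk, ?_, fun l => ?_⟩
      · rw [h3, h1]
        simp only [_root_.mul_inv_rev, map_mul, Subgroup.coe_mul, Units.val_mul, Matrix.mul_assoc]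
      · rw [h4 l, h2 l, map_mul, RestrictedProduct.mul_apply]
        simp only [mul_assoc]

/-- The (complex points of the) Siegel variety `[𝒟 × 𝒦 \ GSp_{2g}(𝔸_f)] / GSp_{2g}(ℚ)` of
genus `g` with level group `𝒦`. For the level group `levelP 𝒦 p` this is the variety `X_p`
of the Hecke correspondence `T_p`, with projections `π₁[x, a] = [x, a]` and
`π₂[x, a] = [x, τ_p a]` to the Siegel variety of level `𝒦`. -/
def SiegelVariety {g : ℕ} (𝒦 : Subgroup (GSpAf g)) : Type := Quotient (shimuraSetoid 𝒦)

/-- The point `[x, a]` of a Siegel variety. -/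
def SiegelVariety.mk {g : ℕ} (𝒦 : Subgroup (GSpAf g)) (x : siegelDomain g) (a : GSpAf g) :
    SiegelVariety 𝒦 := Quotient.mk (shimuraSetoid 𝒦) (x, a)

/-- `c ∈ 𝒦` represents the coset of `𝒦_p \ 𝒦` that corresponds to `σ ∈ S(g)`, that is,
`𝒦 σ = 𝒦 τ_p c`. -/
def Represents {g : ℕ} (𝒦 : Subgroup (GSpAf g)) (p : Nat.Primes) (σ : GSp g ℚ_[p])
    (c : GSpAf g) : Prop :=
  c ∈ 𝒦 ∧ ∃ k ∈ 𝒦, atPlace p σ = k * (atPlace p (tau g p) * c)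

/-- The component of `π₁⁻¹(V_c)` that corresponds to `σ ∈ S(g)`, where `V_c` is the principal
component `{[x, 1] | x ∈ 𝒟_V}` of `V`. It is the set of the points `[x, c]` of `X_p` with
`x ∈ 𝒟_V`, where `c` represents `σ`. -/
def componentOf (r Δ : ℕ) {g : ℕ} (𝒦 : Subgroup (GSpAf g)) (p : Nat.Primes)
    (σ : GSp g ℚ_[p]) : Set (SiegelVariety (levelP 𝒦 p)) :=
  {P | ∃ x : siegelDomain g, (x : Matrix _ _ ℝ) ∈ unitaryDomain g r Δ ∧
    ∃ c, Represents 𝒦 p σ c ∧ P = SiegelVariety.mk _ x c}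

/-- The Shimura subvariety of `X_p` over `V` that corresponds to `σ ∈ S(g)`: the image in `X_p`
of the Shimura variety of the group `GU(r,s)`, conjugated by a representative `c` of `σ`, that
is, the set of the points `[x, c u]` with `x ∈ 𝒟_V` and `u ∈ GU(r,s)(𝔸_f)`. -/
def shimuraSubvarietyOf (r Δ : ℕ) {g : ℕ} (𝒦 : Subgroup (GSpAf g)) (p : Nat.Primes)
    (σ : GSp g ℚ_[p]) : Set (SiegelVariety (levelP 𝒦 p)) :=
  {P | ∃ x : siegelDomain g, (x : Matrix _ _ ℝ) ∈ unitaryDomain g r Δ ∧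
    ∃ c, Represents 𝒦 p σ c ∧ ∃ u ∈ GUAf g r Δ, P = SiegelVariety.mk _ x (c * u)}

/-- The elements of `GSp_{2g}(ℤ_p) τ_p GSp_{2g}(ℤ_p)`, that is, the elements that represent
the elements of `S(g)`. -/
def heckeCoset (g : ℕ) (p : Nat.Primes) : Set (GSp g ℚ_[p]) :=
  {σ | ∃ a ∈ GSpInt g p, ∃ b ∈ GSpInt g p, σ = a * tau g p * b}

/-- D-equivalence: `σ₁` and `σ₂` are D-equivalent if some Shimura subvariety contains both
components of `π₁⁻¹(V_c)` that correspond to `σ₁` and `σ₂`. -/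
def DEquiv (r Δ : ℕ) {g : ℕ} (𝒦 : Subgroup (GSpAf g)) (p : Nat.Primes)
    (σ₁ σ₂ : GSp g ℚ_[p]) : Prop :=
  ∃ σ ∈ heckeCoset g p,
    componentOf r Δ 𝒦 p σ₁ ⊆ shimuraSubvarietyOf r Δ 𝒦 p σ ∧
    componentOf r Δ 𝒦 p σ₂ ⊆ shimuraSubvarietyOf r Δ 𝒦 p σ

/-! ## The partition `𝔇_j` and the matrices `T(σ)` -/

/-- The isotropic subspace `W_σ` of the space `(𝔽_p)^{2g}` of row vectors (the `p`-torsion of the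
abelian variety): the row space of `σ` modulo `p`. -/
def rowSpace {g : ℕ} (p : ℕ) (M : Matrix (Fin g ⊕ Fin g) (Fin g ⊕ Fin g) ℤ) :
    Submodule (ZMod p) (Fin g ⊕ Fin g → ZMod p) :=
  Submodule.span (ZMod p) (Set.range (M.map (Int.cast : ℤ → ZMod p)).row)

/-- The action of `√-Δ ∈ O_K` on the `p`-torsion, by the matrix `α(√-Δ)` on row vectors. -/
def sqrtAction (g r Δ p : ℕ) :
    (Fin g ⊕ Fin g → ZMod p) →ₗ[ZMod p] (Fin g ⊕ Fin g → ZMod p) :=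
  (alphaMat r Δ 0 (1 : Matrix (Fin g) (Fin g) (ZMod p))).vecMulLinear

/-- `s ∈ 𝔇_j` means `dim_{𝔽_p} (𝔽_{p²} W_σ) = j` for `σ = σ(s)`; here
`𝔽_{p²} = 𝔽_p + 𝔽_p √-Δ`, so that `𝔽_{p²} W_σ = W_σ + √-Δ W_σ`. -/
def InStratum {g : ℕ} (r Δ p j : ℕ) (S : Matrix (Fin g) (Fin g) ℤ) : Prop :=
  Module.finrank (ZMod p)
    ↥(rowSpace p (sigmaMat p S) ⊔ (rowSpace p (sigmaMat p S)).map (sqrtAction g r Δ p)) = j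

/-- `T(σ) = E + Δ s E s` for `σ = σ(s)`, `E = E_{r,s}`, an integral matrix. -/
def TMat {g : ℕ} (r Δ : ℕ) (S : Matrix (Fin g) (Fin g) ℤ) : Matrix (Fin g) (Fin g) ℤ :=
  signMat g r ℤ + (Δ : ℤ) • (S * signMat g r ℤ * S)

/-- The reduction of `T(σ)` modulo `p`. -/
def TMatMod {g : ℕ} (r Δ p : ℕ) (S : Matrix (Fin g) (Fin g) ℤ) :
    Matrix (Fin g) (Fin g) (ZMod p) :=
  (TMat r Δ S).map (Int.cast : ℤ → ZMod p)

end SiegelHecke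

end

/-! Write I for the matrix α(√-Δ). Composing I with the alternating form J gives a symmetric form
IJ, and T(σ) is its Gram matrix on the rows of (E_g, S) (`hermMat_eq`). These rows and their images
under I form a square matrix with determinant det T(σ), whence the description of the generic
stratum (`inStratum_iff`).

Sufficiency. If T is invertible over ℤ_p, the rows of (E_g, S) are a basis over ℤ_p[√-Δ], in which I
has a fixed matrix and J depends only on T. A congruence between c T(σ₂) and T(σ₁), with c a unit,
therefore yields an integral unitary similitude that carries one graph to the other
(`exists_GUimage_graphMat`), and both components lie in one Shimura subvariety
(`dEquiv_of_unitary`). For p odd, unimodular symmetric matrices over ℤ_p are classified by the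
square class of the determinant (`congruent_of_isSquare`), which is visible modulo p. The scalar c
changes the determinant by c^g, so that it can correct the square class precisely when g is odd.

Necessity. If a component lies in a Shimura subvariety, its points x come with rational similitudes
γ such that γ⁻¹xγ is again in 𝒟_V. Points of 𝒟_V commute with I, so x commutes with γIγ⁻¹. There are
countably many γ, and a Baire category argument provides an x for which this forces γIγ⁻¹ = ±I
(`exists_generic`). At p this leaves an integral w, linear or antilinear over K, relating the two
cosets (`exists_antilinear_of_subset`). Such a w multiplies IJ by a unit, so that P T(σ₂) Pᵗ = c
T(σ₁) modulo p (`DEquiv.exists_TMatMod_eq`). Taking determinants, invertibility of T is an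
invariant, and for even g so is the square class of det T. As -Δ is not a square modulo p, both
classes occur (`exists_det_TMatMod`). -/

noncomputable section

/-! ## Congruence of symmetric matrices -/

namespace Matrix

section Congruent

variable {ι : Type*} [Fintype ι] [DecidableEq ι] {R : Type*} [CommRing R]

/-- `B = P A Pᵗ` for some invertible matrix `P`. -/
def IsCongruent (A B : Matrix ι ι R) : Prop :=
  ∃ P : Matrix ι ι R, IsUnit P.det ∧ P * A * Pᵀ = B

theorem IsCongruent.trans {A B C : Matrix ι ι R} :
    IsCongruent A B → IsCongruent B C → IsCongruent A C := by
  rintro ⟨P, hP, rfl⟩ ⟨Q, hQ, rfl⟩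
  exact ⟨Q * P, by rw [det_mul]; exact hQ.mul hP, by simp only [transpose_mul, Matrix.mul_assoc]⟩

theorem IsCongruent.refl (A : Matrix ι ι R) : IsCongruent A A := ⟨1, by simp, by simp⟩

theorem IsCongruent.symm {A B : Matrix ι ι R} (h : IsCongruent A B) : IsCongruent B A := by
  obtain ⟨P, hP, h⟩ := h
  have hP' : IsUnit Pᵀ.det := by rwa [det_transpose]
  refine ⟨P⁻¹, by rwa [isUnit_nonsing_inv_det_iff], ?_⟩
  rw [← h, transpose_nonsing_inv, ← Matrix.mul_assoc, ← Matrix.mul_assoc, nonsing_inv_mul _ hP,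
    Matrix.one_mul, Matrix.mul_assoc, mul_nonsing_inv _ hP', Matrix.mul_one]

theorem IsCongruent.of_eq {P A B : Matrix ι ι R} (h : P * A * Pᵀ = B) (hB : IsUnit B.det) :
    IsCongruent A B := by
  refine ⟨P, ?_, h⟩
  rw [← h, det_mul, det_mul] at hB
  exact isUnit_of_mul_isUnit_left (isUnit_of_mul_isUnit_left hB)

theorem IsCongruent.det {A B : Matrix ι ι R} (h : IsCongruent A B) :
    ∃ e : R, IsUnit e ∧ B.det = e ^ 2 * A.det := by
  obtain ⟨P, hP, rfl⟩ := h
  exact ⟨P.det, hP, by simp only [det_mul, det_transpose]; ring⟩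

theorem IsCongruent.isUnit_det {A B : Matrix ι ι R} (h : IsCongruent A B) (hA : IsUnit A.det) :
    IsUnit B.det := by
  obtain ⟨e, he, h⟩ := h.det
  rw [h]
  exact (he.pow 2).mul hA

theorem IsCongruent.isSymm {A B : Matrix ι ι R} (h : IsCongruent A B) (hA : A.IsSymm) :
    B.IsSymm := by
  obtain ⟨P, -, rfl⟩ := h
  simp only [IsSymm, transpose_mul, transpose_transpose, hA.eq, Matrix.mul_assoc]

theorem IsCongruent.submatrix {κ : Type*} [Fintype κ] [DecidableEq κ] {A B : Matrix ι ι R}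
    (h : IsCongruent A B) (e : κ ≃ ι) : IsCongruent (A.submatrix e e) (B.submatrix e e) := by
  obtain ⟨P, hP, rfl⟩ := h
  exact ⟨P.submatrix e e, by rwa [det_submatrix_equiv_self],
    by simp [transpose_submatrix, submatrix_mul_equiv]⟩

theorem IsCongruent.fromBlocks {κ : Type*} [Fintype κ] [DecidableEq κ] (A : Matrix ι ι R)
    {C D : Matrix κ κ R} (h : IsCongruent C D) :
    IsCongruent (fromBlocks A 0 0 C) (fromBlocks A 0 0 D) := by
  obtain ⟨P, hP, rfl⟩ := h
  exact ⟨Matrix.fromBlocks 1 0 0 P, by simpa using hP,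
    by simp [fromBlocks_transpose, fromBlocks_multiply]⟩

end Congruent

/-! ### Diagonalization of symmetric matrices over local rings -/

section Local

variable {R : Type*} [CommRing R] [IsLocalRing R]

open IsLocalRing

/-- A symmetric matrix with invertible determinant over a local ring in which `2` is a unit
is congruent to a matrix with an invertible diagonal entry. -/
theorem exists_congruent_isUnit_diag {ι : Type*} [Fintype ι] [DecidableEq ι] [Nonempty ι]
    (h2 : IsUnit (2 : R)) {A : Matrix ι ι R}
    (hA : A.IsSymm) (hdet : IsUnit A.det) : ∃ B, IsCongruent A B ∧ ∃ k, IsUnit (B k k) := by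
  by_cases h : ∃ k, IsUnit (A k k)
  · exact ⟨A, .refl A, h⟩
  push Not at h
  obtain ⟨i, j, hij⟩ : ∃ i j, IsUnit (A i j) := by
    by_contra! hcon
    have h0 : A.map (residue R) = 0 := by
      ext i j
      rw [map_apply, zero_apply, residue_eq_zero_iff, mem_maximalIdeal]
      exact hcon i j
    have := hdet.map (residue R)
    rw [RingHom.map_det, RingHom.mapMatrix_apply, h0, det_zero] at this
    exact not_isUnit_zero this
  have hne : i ≠ j := fun e => h i (by simpa [e] using hij)
  -- Adding row j to row i and likewise for columns gives the diagonal entry A i i + 2 A i j + A j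
  -- j, a unit because its middle term is one and the others are not.
  refine ⟨_, ⟨transvection i j 1, by simp [det_transvection_of_ne _ _ hne], rfl⟩, i, ?_⟩
  have hT : (transvection i j (1 : R))ᵀ = 1 + Matrix.single j i 1 := by
    rw [transvection, transpose_add, transpose_one, transpose_single]
  have key : (transvection i j (1 : R) * A * (transvection i j (1 : R))ᵀ : Matrix ι ι R) i i
      = A i i + A j i + (A i j + A j j) := by
    rw [hT, transvection]
    simp only [Matrix.mul_add, Matrix.add_apply, Matrix.add_mul, mul_single_apply_same,
      single_mul_apply_same, mul_one, one_mul]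
  rw [key, hA.apply i j]
  by_contra hcon
  have hij2 : IsUnit (2 * A i j) := h2.mul hij
  have e : 2 * A i j = (A i i + A i j + (A i j + A j j)) - A i i - A j j := by ring
  rw [e] at hij2
  refine (mem_maximalIdeal _).1 (Ideal.sub_mem _ (Ideal.sub_mem _ ?_ ?_) ?_) hij2
  exacts [(mem_maximalIdeal _).2 hcon, (mem_maximalIdeal _).2 (h i), (mem_maximalIdeal _).2 (h j)]

/-- Induction on the size: a unit diagonal entry is split off by means of its Schur complement. The
index type is quantified inside the induction because the complement is indexed by a subtype. -/
theorem exists_congruent_diagonal (h2 : IsUnit (2 : R)) (n : ℕ) :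
    ∀ (ι : Type) [Fintype ι] [DecidableEq ι], Fintype.card ι = n →
    ∀ A : Matrix ι ι R, A.IsSymm → IsUnit A.det → ∃ d, IsCongruent A (diagonal d) := by
  induction n with
  | zero =>
    intro ι _ _ hι A _ _
    have := Fintype.card_eq_zero_iff.1 hι
    exact ⟨0, 1, by simp, Subsingleton.elim _ _⟩
  | succ n ih =>
    intro ι _ _ hι A hA hdet
    have : Nonempty ι := Fintype.card_pos_iff.1 (by omega)
    obtain ⟨B, hAB, k, hk⟩ := exists_congruent_isUnit_diag h2 hA hdet
    let e : {x // x = k} ⊕ {x // ¬ x = k} ≃ ι := Equiv.sumCompl (· = k)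
    obtain ⟨M, hM⟩ : ∃ M, M = B.submatrix e e := ⟨_, rfl⟩
    have hMs : M.IsSymm := hM ▸ (hAB.isSymm hA).submatrix e
    have hMdet : IsUnit M.det := by
      rw [hM, det_submatrix_equiv_self]
      exact hAB.isUnit_det hdet
    have hM11 : IsUnit M.toBlocks₁₁.det := by
      rw [det_unique, hM]
      exact hk
    let _ : Invertible M.toBlocks₁₁ := invertibleOfIsUnitDet _ hM11
    have hsch := fromBlocks_eq_of_invertible₁₁ M.toBlocks₁₁ M.toBlocks₁₂ M.toBlocks₂₁ M.toBlocks₂₂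
    rw [fromBlocks_toBlocks] at hsch
    obtain ⟨C, hC⟩ : ∃ C, C = M.toBlocks₂₂ - M.toBlocks₂₁ * ⅟M.toBlocks₁₁ * M.toBlocks₁₂ :=
      ⟨_, rfl⟩
    rw [← hC] at hsch
    have hMs' := hMs
    rw [← fromBlocks_toBlocks M, isSymm_fromBlocks_iff] at hMs'
    have hcong : IsCongruent (fromBlocks M.toBlocks₁₁ 0 0 C) M := by
      refine ⟨fromBlocks 1 0 (M.toBlocks₂₁ * ⅟M.toBlocks₁₁) 1, by simp, ?_⟩
      conv_rhs => rw [hsch]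
      rw [fromBlocks_transpose]
      simp only [transpose_one, transpose_zero, transpose_mul, hMs'.2.2.1]
      rw [invOf_eq_nonsing_inv, transpose_nonsing_inv, hMs'.1.eq]
    have hdiag := hcong.symm.isSymm hMs
    have hCs : C.IsSymm := (isSymm_fromBlocks_iff.1 hdiag).2.2.2
    have hCdet : IsUnit C.det := by
      have := hcong.symm.isUnit_det hMdet
      rw [det_fromBlocks_zero₂₁] at this
      exact isUnit_of_mul_isUnit_right this
    have hcard : Fintype.card {x // ¬ x = k} = n := by
      rw [Fintype.card_subtype_compl, Fintype.card_subtype_eq, hι]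
      rfl
    obtain ⟨d, hd⟩ := ih {x // ¬ x = k} hcard C hCs hCdet
    have h11 : M.toBlocks₁₁ = diagonal fun _ => B k k := by
      ext ⟨i, rfl⟩ ⟨j, rfl⟩
      simp [hM, toBlocks₁₁, e]
    have h3 := hcong.symm.trans (hd.fromBlocks M.toBlocks₁₁)
    rw [h11, fromBlocks_diagonal, hM] at h3
    have h4 := h3.submatrix e.symm
    rw [submatrix_submatrix, submatrix_diagonal_equiv] at h4
    simp only [Equiv.self_comp_symm, submatrix_id_id] at h4
    exact ⟨_, hAB.trans h4⟩

end Local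

/-! ### Classification of unimodular symmetric matrices over `ℤ_[p]`, p odd -/

section Padic

variable {p : ℕ} [Fact p.Prime]

theorem isUnit_iff_toZMod_ne_zero {x : ℤ_[p]} : IsUnit x ↔ PadicInt.toZMod x ≠ 0 := by
  rw [ne_eq, ← RingHom.mem_ker, PadicInt.ker_toZMod, IsLocalRing.mem_maximalIdeal, mem_nonunits_iff,
    not_not]

theorem isUnit_two (hp : p ≠ 2) : IsUnit (2 : ℤ_[p]) := by
  rw [isUnit_iff_toZMod_ne_zero, map_ofNat]
  exact Ring.two_ne_zero (by rwa [ZMod.ringChar_zmod_n])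

/-- Hensel's lemma for X² - x at a lift a of the root modulo p; the derivative 2a is a unit since p
is odd. -/
theorem isSquare_of_isSquare_toZMod (hp : p ≠ 2) {x : ℤ_[p]} (hx : IsUnit x)
    (h : IsSquare (PadicInt.toZMod x)) : ∃ y, IsUnit y ∧ x = y ^ 2 := by
  obtain ⟨b, hb⟩ := h
  obtain ⟨a, rfl⟩ := ZMod.ringHom_surjective (PadicInt.toZMod (p := p)) b
  have hx0 := isUnit_iff_toZMod_ne_zero.1 hx
  have ha : IsUnit a := by
    rw [isUnit_iff_toZMod_ne_zero]
    rintro h0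
    simp [h0] at hb
    exact hx0 hb
  have hn : ‖2 * a‖ = 1 := PadicInt.isUnit_iff.1 ((isUnit_two hp).mul ha)
  have hlt : ‖a ^ 2 - x‖ < 1 := by
    have : ¬ IsUnit (a ^ 2 - x) := by
      rw [isUnit_iff_toZMod_ne_zero, not_not, map_sub, map_pow, hb]
      ring
    rw [PadicInt.isUnit_iff] at this
    exact lt_of_le_of_ne (PadicInt.norm_le_one _) this
  obtain ⟨z, hz, -⟩ := hensels_lemma (p := p) (R := ℤ_[p])
    (F := Polynomial.X ^ 2 - Polynomial.C x) (a := a) (by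
      have e : (Polynomial.X ^ 2 - Polynomial.C x).derivative.eval a = 2 * a := by
        simp [one_add_one_eq_two]
      simp only [Polynomial.coe_aeval_eq_eval]
      rw [e, hn, one_pow]
      simpa using hlt)
  have hz' : x = z ^ 2 := by
    simp [sub_eq_zero] at hz
    exact hz.symm
  refine ⟨z, ?_, hz'⟩
  rw [hz'] at hx
  exact (isUnit_pow_iff two_ne_zero).1 hx

/-- A binary diagonal form with unit coefficients over `ℤ_p` represents `1`. -/
theorem exists_sq_add_sq_eq_one (hp : p ≠ 2) {a b : ℤ_[p]} (ha : IsUnit a) (hb : IsUnit b) :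
    ∃ x y, a * x ^ 2 + b * y ^ 2 = 1 := by
  -- A solution modulo p lifts by keeping y and taking the square root of (1 - b y²)/a, which needs
  -- the other coordinate to be nonzero modulo p. One of the two coordinates always is.
  have aux : ∀ {a b : ℤ_[p]}, IsUnit a → ∀ x y : ℤ_[p], PadicInt.toZMod x ≠ 0 →
      PadicInt.toZMod (a * x ^ 2 + b * y ^ 2) = 1 → ∃ x' y', a * x' ^ 2 + b * y' ^ 2 = 1 := by
    rintro _ b ⟨a, rfl⟩ x y hx h
    have e : PadicInt.toZMod (1 - b * y ^ 2) = PadicInt.toZMod ((a : ℤ_[p]) * x ^ 2) := by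
      rw [map_add] at h
      rw [map_sub, map_one, ← h]
      ring
    have e2 : PadicInt.toZMod (((a⁻¹ : ℤ_[p]ˣ) : ℤ_[p]) * (1 - b * y ^ 2))
        = PadicInt.toZMod x ^ 2 := by
      rw [map_mul, e, ← map_mul, Units.inv_mul_cancel_left, map_pow]
    obtain ⟨z, -, hz⟩ := isSquare_of_isSquare_toZMod hp
      (x := ((a⁻¹ : ℤ_[p]ˣ) : ℤ_[p]) * (1 - b * y ^ 2))
      (by rw [isUnit_iff_toZMod_ne_zero, e2]; exact pow_ne_zero 2 hx) (by rw [e2]; exact .sq _)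
    refine ⟨z, y, ?_⟩
    rw [← hz, Units.mul_inv_cancel_left]
    ring
  have ha0 := isUnit_iff_toZMod_ne_zero.1 ha
  have hb0 := isUnit_iff_toZMod_ne_zero.1 hb
  obtain ⟨x, y, hxy⟩ := FiniteField.exists_root_sum_quadratic (R := ZMod p)
    (f := Polynomial.C (PadicInt.toZMod a) * Polynomial.X ^ 2)
    (g := Polynomial.C (PadicInt.toZMod b) * Polynomial.X ^ 2 - Polynomial.C 1)
    (Polynomial.degree_C_mul_X_pow 2 ha0)
    (by
      have := Polynomial.degree_C_mul_X_pow 2 hb0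
      rw [Polynomial.degree_sub_C (by rw [this]; exact_mod_cast two_pos), this]
      rfl)
    (by rw [ZMod.card]; exact (Fact.out : p.Prime).eq_two_or_odd.resolve_left hp)
  simp only [Polynomial.eval_mul, Polynomial.eval_C, Polynomial.eval_pow, Polynomial.eval_X,
    Polynomial.eval_sub] at hxy
  obtain ⟨x, rfl⟩ := ZMod.ringHom_surjective (PadicInt.toZMod (p := p)) x
  obtain ⟨y, rfl⟩ := ZMod.ringHom_surjective (PadicInt.toZMod (p := p)) y
  have h1 : PadicInt.toZMod (a * x ^ 2 + b * y ^ 2) = 1 := by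
    simp only [map_add, map_mul, map_pow]
    linear_combination hxy
  by_cases hx : PadicInt.toZMod x = 0
  · have hy : PadicInt.toZMod y ≠ 0 := by
      intro hy
      simp [hx, hy] at h1
    obtain ⟨y', x', h⟩ := aux hb y x hy (by rw [add_comm]; exact h1)
    exact ⟨x', y', by rw [add_comm]; exact h⟩
  · exact aux ha x y hx h1

variable {ι : Type*} [Fintype ι] [DecidableEq ι]

/-- Two unit entries of a diagonal matrix over `ℤ_p` can be replaced by `1` and their product. -/
theorem congruent_diagonal_update (hp : p ≠ 2) {d : ι → ℤ_[p]} (hd : ∀ k, IsUnit (d k)) {i j : ι}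
    (hij : i ≠ j) :
    IsCongruent (diagonal d) (diagonal (Function.update (Function.update d i 1) j (d i * d j))) := by
  obtain ⟨x, y, hxy⟩ := exists_sq_add_sq_eq_one hp (hd i) (hd j)
  -- With a x² + b y² = 1 for a = d i, b = d j, the vector (x, y) has norm 1; the vector (-b y, a x)
  -- is orthogonal to it and has norm ab.
  refine .of_eq (P := Matrix.of fun k => if k = i then Pi.single i x + Pi.single j y
    else if k = j then Pi.single i (-(d j * y)) + Pi.single j (d i * x) else Pi.single k 1) ?_ ?_
  · ext k l
    rw [mul_apply]
    simp only [mul_diagonal, transpose_apply, of_apply]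
    have hji := hij.symm
    by_cases hki : k = i <;> by_cases hli : l = i <;> by_cases hkj : k = j <;>
      by_cases hlj : l = j <;> try subst hki
    all_goals try subst hli
    all_goals try subst hkj
    all_goals try subst hlj
    all_goals simp_all [Pi.single_apply, add_mul, mul_add, Finset.sum_add_distrib, diagonal_apply]
    all_goals first
      | linear_combination hxy
      | linear_combination (d i * d l) * hxy
      | ring1
      | grind
  · rw [det_diagonal]
    refine IsUnit.prod_iff.2 fun k _ => ?_
    by_cases hkj : k = j
    · subst hkj
      simpa using ⟨hd i, hd k⟩
    · by_cases hki : k = i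
      · subst hki
        simp [hkj]
      · simp [hkj, hki, hd k]

/-- The entries other than the i-th are absorbed into it one at a time by
`congruent_diagonal_update`. -/
theorem congruent_diagonal_prod (hp : p ≠ 2) {d : ι → ℤ_[p]} (hd : ∀ k, IsUnit (d k)) (i : ι) :
    IsCongruent (diagonal d) (diagonal (Function.update 1 i (∏ k, d k))) := by
  have key : ∀ s : Finset ι, i ∉ s → IsCongruent (diagonal d) (diagonal
      (Function.update (fun k => if k ∈ s then 1 else d k) i (d i * ∏ k ∈ s, d k))) := by
    intro s
    induction s using Finset.induction_on with
    | empty => intro; simpa using IsCongruent.refl (diagonal d)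
    | insert a s ha ih =>
      intro hi
      rw [Finset.mem_insert, not_or] at hi
      refine (ih hi.2).trans ?_
      have h := congruent_diagonal_update hp
        (d := Function.update (fun k => if k ∈ s then 1 else d k) i (d i * ∏ k ∈ s, d k))
        (fun k => ?_) (Ne.symm hi.1)
      · convert h using 2
        ext k
        by_cases hki : k = i
        · subst hki
          simp [ha, Ne.symm hi.1, Finset.prod_insert ha]
          ring
        · by_cases hka : k = a
          · subst hka
            simp [hki]
          · simp [hki, hka]
      · by_cases hki : k = i
        · subst hki
          simpa using ⟨hd k, fun a _ => hd a⟩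
        · by_cases hks : k ∈ s <;> simp [hki, hks, hd k]
  have := key (Finset.univ.erase i) (by simp)
  rw [Finset.mul_prod_erase _ _ (Finset.mem_univ i)] at this
  convert this using 2
  ext k
  by_cases hki : k = i
  · subst hki; simp
  · simp [hki]

/-- Symmetric unimodular matrices over `ℤ_p`, `p ≠ 2`, are classified by the determinant. -/
theorem congruent_of_isSquare {ι : Type} [Fintype ι] [DecidableEq ι] [Nonempty ι] (hp : p ≠ 2)
    {A B : Matrix ι ι ℤ_[p]} (hA : A.IsSymm) (hB : B.IsSymm) (hAd : IsUnit A.det)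
    (hBd : IsUnit B.det) (h : IsSquare (PadicInt.toZMod (A.det * B.det))) : IsCongruent A B := by
  obtain ⟨i⟩ := ‹Nonempty ι›
  have aux : ∀ A : Matrix ι ι ℤ_[p], A.IsSymm → IsUnit A.det →
      ∃ d, IsCongruent A (diagonal (Function.update 1 i d)) := by
    intro A hA hAd
    obtain ⟨d, hd⟩ := exists_congruent_diagonal (isUnit_two hp) _ ι rfl A hA hAd
    have hdu := hd.isUnit_det hAd
    rw [det_diagonal, IsUnit.prod_univ_iff] at hdu
    exact ⟨_, hd.trans (congruent_diagonal_prod hp hdu i)⟩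
  obtain ⟨a, ha⟩ := aux A hA hAd
  obtain ⟨b, hb⟩ := aux B hB hBd
  have hdet : ∀ c : ℤ_[p], (diagonal (Function.update (1 : ι → ℤ_[p]) i c)).det = c := by
    intro c
    rw [det_diagonal, Finset.prod_update_of_mem (Finset.mem_univ i)]
    simp
  obtain ⟨e, he, hae⟩ := ha.det
  obtain ⟨f, hf, hbf⟩ := hb.det
  obtain ⟨y, hy, hABy⟩ := isSquare_of_isSquare_toZMod hp (hAd.mul hBd) h
  rw [hdet] at hae hbf
  have hau : IsUnit a := by rw [hae]; exact (he.pow 2).mul hAd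
  have hbu : IsUnit b := by rw [hbf]; exact (hf.pow 2).mul hBd
  obtain ⟨a, rfl⟩ := hau
  -- From ab = (e f y)², scaling the i-th coordinate by e f y / a turns a into b.
  refine (ha.trans (.of_eq (P := diagonal (Function.update 1 i (e * f * y * (a⁻¹ : ℤ_[p]ˣ)))) ?_
    (by rw [hdet]; exact hbu))).trans hb.symm
  rw [diagonal_transpose, diagonal_mul_diagonal, diagonal_mul_diagonal]
  congr 1
  ext k
  by_cases hki : k = i
  · subst hki
    simp only [Function.update_self]
    have ha' : (a : ℤ_[p]) * (a⁻¹ : ℤ_[p]ˣ) = 1 := a.mul_inv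
    have : (a : ℤ_[p]) * b = (e * f * y) ^ 2 := by
      rw [hae, hbf]
      linear_combination (e * f) ^ 2 * hABy
    linear_combination
      (-(a⁻¹ : ℤ_[p]ˣ) : ℤ_[p]) * this + (e * f * y) ^ 2 * (a⁻¹ : ℤ_[p]ˣ) * ha' + b * ha'
  · simp [hki]

end Padic

end Matrix

namespace SiegelHecke

theorem map_zsmul_matrix {R S m n : Type*} [Ring R] [Ring S] (f : R →+* S) (e : ℤ)
    (A : Matrix m n R) : (e • A).map f = e • A.map f := by
  ext i j
  rw [map_apply, Matrix.smul_apply, Matrix.smul_apply, map_apply, map_zsmul]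

/-! ### The matrix of √-Δ and the matrix T over an arbitrary ring -/

section Algebra

variable {g : ℕ} {R : Type*} [CommRing R]

@[simp] theorem signMat_mul_self (r : ℕ) : signMat g r R * signMat g r R = 1 := by
  rw [signMat, diagonal_mul_diagonal, ← diagonal_one]
  congr 1
  ext i
  by_cases h : (i : ℕ) < r <;> simp [h]

@[simp] theorem signMat_mul_signMat_mul (r : ℕ) (A : Matrix (Fin g) (Fin g) R) :
    signMat g r R * (signMat g r R * A) = A := by
  rw [← Matrix.mul_assoc, signMat_mul_self, Matrix.one_mul]

@[simp] theorem signMat_transpose (r : ℕ) : (signMat g r R)ᵀ = signMat g r R :=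
  diagonal_transpose _

@[simp] theorem signMat_map (r : ℕ) {S : Type*} [CommRing S] (f : R →+* S) :
    (signMat g r R).map f = signMat g r S := by
  rw [signMat, diagonal_map (map_zero f), signMat]
  congr 1
  ext i
  by_cases h : (i : ℕ) < r <;> simp [h]

theorem isUnit_det_signMat (r : ℕ) : IsUnit (signMat g r R).det := by
  have h := congrArg Matrix.det (signMat_mul_self (g := g) (R := R) r)
  rw [det_mul, det_one] at h
  exact IsUnit.of_mul_eq_one _ h

/-- A matrix that satisfies the similitude relation with an invertible multiplier belongs to
`GSp_{2g}`. -/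
theorem GSp.exists_val_eq {M : Matrix (Fin g ⊕ Fin g) (Fin g ⊕ Fin g) R} {c : R} (hc : IsUnit c)
    (h : M * J (Fin g) R * Mᵀ = c • J (Fin g) R) : ∃ x : GSp g R, x.1.1 = M := by
  obtain ⟨c, rfl⟩ := hc
  have h1 : M * (-((c⁻¹ : Rˣ) : R) • (J (Fin g) R * Mᵀ * J (Fin g) R)) = 1 := by
    rw [Matrix.mul_smul, ← Matrix.mul_assoc, ← Matrix.mul_assoc, h, Matrix.smul_mul, J_squared,
      smul_smul]
    simp
  exact ⟨⟨⟨M, _, h1, mul_eq_one_comm.1 h1⟩, c, h⟩, rfl⟩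

theorem GSp.ext_val {x y : GSp g R} (h : x.1.1 = y.1.1) : x = y := Subtype.ext (Units.ext h)

theorem GSp.val_mul (x y : GSp g R) : (x * y).1.1 = x.1.1 * y.1.1 := rfl

theorem GSp.val_mul_inv (x : GSp g R) : x.1.1 * (x⁻¹).1.1 = 1 := by
  rw [← GSp.val_mul, mul_inv_cancel]; rfl

theorem GSp.val_inv_mul (x : GSp g R) : (x⁻¹).1.1 * x.1.1 = 1 := by
  rw [← GSp.val_mul, inv_mul_cancel]; rfl

theorem GSp.val_map {S : Type*} [CommRing S] (f : R →+* S) (x : GSp g R) :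
    (GSp.map f x).1.1 = x.1.1.map f := rfl

/-- The matrix `α(√-Δ)`. -/
def sqrtMat (g r Δ : ℕ) (R : Type*) [CommRing R] : Matrix (Fin g ⊕ Fin g) (Fin g ⊕ Fin g) R :=
  alphaMat r Δ 0 (1 : Matrix (Fin g) (Fin g) R)

theorem sqrtMat_eq (r Δ : ℕ) : sqrtMat g r Δ R =
    fromBlocks 0 (signMat g r R) (-((Δ : R) • signMat g r R)) 0 := by
  simp [sqrtMat, alphaMat]

theorem sqrtMat_map (r Δ : ℕ) {S : Type*} [CommRing S] (f : R →+* S) :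
    (sqrtMat g r Δ R).map f = sqrtMat g r Δ S := by
  have h : (-((Δ : R) • signMat g r R)).map f = -((Δ : S) • (signMat g r R).map f) := by
    ext; simp [-signMat_map]
  rw [sqrtMat_eq, sqrtMat_eq, fromBlocks_map, h, signMat_map, Matrix.map_zero _ (map_zero f)]

theorem sqrtMat_mul_self (r Δ : ℕ) : sqrtMat g r Δ R * sqrtMat g r Δ R = -((Δ : R) • 1) := by
  rw [sqrtMat_eq, fromBlocks_multiply, ← fromBlocks_one, fromBlocks_smul, fromBlocks_neg]
  simp

theorem sqrtMat_mul_J (r Δ : ℕ) : sqrtMat g r Δ R * J (Fin g) R =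
    fromBlocks (signMat g r R) 0 0 ((Δ : R) • signMat g r R) := by
  rw [sqrtMat_eq, J, fromBlocks_multiply]
  simp

theorem alphaMat_comm_sqrtMat (r Δ : ℕ) (h k : Matrix (Fin g) (Fin g) R) :
    alphaMat r Δ h k * sqrtMat g r Δ R = sqrtMat g r Δ R * alphaMat r Δ h k := by
  rw [sqrtMat_eq, alphaMat, fromBlocks_multiply, fromBlocks_multiply]
  simp [Matrix.mul_assoc]

theorem alphaMat_one (r Δ : ℕ) : alphaMat r Δ (1 : Matrix (Fin g) (Fin g) R) 0 = 1 := by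
  simp [alphaMat]

theorem alphaMat_mul_J_mul_transpose (r Δ : ℕ) {h k : Matrix (Fin g) (Fin g) R} {c : R}
    (h1 : h * signMat g r R * hᵀ + (Δ : R) • (k * signMat g r R * kᵀ) = c • signMat g r R)
    (h2 : k * signMat g r R * hᵀ = h * signMat g r R * kᵀ) :
    alphaMat r Δ h k * J (Fin g) R * (alphaMat r Δ h k)ᵀ = c • J (Fin g) R := by
  have h1' : (Δ : R) • (k * (signMat g r R * kᵀ)) =
      c • signMat g r R - h * (signMat g r R * hᵀ) := by
    rw [← h1]; simp [Matrix.mul_assoc]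
  have h2' : k * (signMat g r R * hᵀ) = h * (signMat g r R * kᵀ) := by
    simpa only [Matrix.mul_assoc] using h2
  rw [alphaMat, J, fromBlocks_transpose, fromBlocks_multiply, fromBlocks_multiply, fromBlocks_smul]
  simp only [transpose_mul, transpose_neg, transpose_smul, signMat_transpose, Matrix.mul_assoc,
    Matrix.mul_zero, Matrix.mul_one, Matrix.mul_neg, Matrix.neg_mul, zero_add, add_zero,
    smul_zero, smul_neg, neg_neg, Matrix.smul_mul, Matrix.mul_smul]
  have a1 : (Δ : R) • (k * (signMat g r R * (kᵀ * signMat g r R))) =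
      c • 1 - h * (signMat g r R * (hᵀ * signMat g r R)) := by
    have := congrArg (· * signMat g r R) h1'
    simpa [Matrix.sub_mul, Matrix.mul_assoc] using this
  have a2 : (Δ : R) • (signMat g r R * (k * (signMat g r R * kᵀ))) =
      c • 1 - signMat g r R * (h * (signMat g r R * hᵀ)) := by
    have := congrArg (signMat g r R * ·) h1'
    simpa [Matrix.mul_sub] using this
  have a3 : k * (signMat g r R * (hᵀ * signMat g r R))
      = h * (signMat g r R * (kᵀ * signMat g r R)) := by
    have := congrArg (· * signMat g r R) h2'
    simpa [Matrix.mul_assoc] using this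
  rw [a1, a2, h2', a3]
  congr 1
  · simp
  · simp only [neg_sub]; abel
  · simp
  · simp

theorem GUimage_of_isGU {r Δ : ℕ} {h k : Matrix (Fin g) (Fin g) R} (H : IsGU r Δ h k) :
    ∃ x ∈ GUimage g r Δ R, x.1.1 = alphaMat r Δ h k := by
  obtain ⟨⟨c, hc⟩, h2⟩ := H
  obtain ⟨x, hx⟩ := GSp.exists_val_eq c.isUnit (alphaMat_mul_J_mul_transpose r Δ hc h2)
  exact ⟨x, ⟨h, k, ⟨⟨c, hc⟩, h2⟩, hx⟩, hx⟩

theorem one_mem_GUimage (r Δ : ℕ) : (1 : GSp g R) ∈ GUimage g r Δ R :=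
  ⟨1, 0, ⟨⟨1, by simp⟩, by simp⟩, (alphaMat_one r Δ).symm⟩

theorem GUimage_comm_sqrtMat {r Δ : ℕ} {x : GSp g R} (hx : x ∈ GUimage g r Δ R) :
    x.1.1 * sqrtMat g r Δ R = sqrtMat g r Δ R * x.1.1 := by
  obtain ⟨h, k, -, hx⟩ := hx
  rw [hx, alphaMat_comm_sqrtMat]

/-- The matrix `E + Δ S E S` over an arbitrary ring. -/
def hermMat (r Δ : ℕ) (S : Matrix (Fin g) (Fin g) R) : Matrix (Fin g) (Fin g) R :=
  signMat g r R + (Δ : R) • (S * signMat g r R * S)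

theorem hermMat_map (r Δ : ℕ) {R' : Type*} [CommRing R'] (f : R →+* R')
    (S : Matrix (Fin g) (Fin g) R) : (hermMat r Δ S).map f = hermMat r Δ (S.map f) := by
  have : ((Δ : R) • (S * signMat g r R * S)).map f
      = (Δ : R') • (S * signMat g r R * S).map f := by
    ext; simp [-Matrix.map_mul]
  rw [hermMat, hermMat, Matrix.map_add _ (map_add f), signMat_map, this, Matrix.map_mul,
    Matrix.map_mul, signMat_map]

theorem TMatMod_eq (r Δ p : ℕ) (S : Matrix (Fin g) (Fin g) ℤ) :
    TMatMod r Δ p S = hermMat r Δ (S.map (Int.cast : ℤ → ZMod p)) := by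
  have := hermMat_map r Δ (Int.castRingHom (ZMod p)) S
  simpa [TMatMod, TMat, hermMat] using this

/-- The matrix `(E_g, S)`. -/
def graphMat (S : Matrix (Fin g) (Fin g) R) : Matrix (Fin g) (Fin g ⊕ Fin g) R := fromCols 1 S

theorem hermMat_isSymm (r Δ : ℕ) {S : Matrix (Fin g) (Fin g) R} (hS : S.IsSymm) :
    (hermMat r Δ S).IsSymm := by
  simp [IsSymm, hermMat, hS.eq, Matrix.mul_assoc]

/-- This makes T intrinsic: it is the Gram matrix on the graph of the symmetric form attached to
√-Δ. A change of basis of the graph changes T by a congruence, and a map that scales the form scales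
T. -/
theorem hermMat_eq (r Δ : ℕ) {S : Matrix (Fin g) (Fin g) R} (hS : S.IsSymm) :
    graphMat S * (sqrtMat g r Δ R * J (Fin g) R) * (graphMat S)ᵀ = hermMat r Δ S := by
  rw [graphMat, sqrtMat_mul_J, transpose_fromCols, fromCols_mul_fromBlocks, fromCols_mul_fromRows,
    hS.eq, hermMat]
  simp

theorem graphMat_mul_sqrtMat (r Δ : ℕ) (S : Matrix (Fin g) (Fin g) R) :
    graphMat S * sqrtMat g r Δ R =
      fromCols (-((Δ : R) • (S * signMat g r R))) (signMat g r R) := by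
  rw [graphMat, sqrtMat_eq, fromCols_mul_fromBlocks]
  simp

end Algebra

/-! ### The generic stratum and the invertibility of T -/

section Stratum

variable {g : ℕ}

/-- W_σ + √-Δ W_σ is the row space of the square matrix with rows (1, s) and √-Δ (1, s), whose Schur
complement with respect to the block 1 is T(σ). -/
theorem inStratum_iff {r Δ p : ℕ} [Fact p.Prime] (S : Matrix (Fin g) (Fin g) ℤ) :
    InStratum r Δ p (2 * g) S ↔ IsUnit (TMatMod r Δ p S) := by
  set s := S.map (Int.cast : ℤ → ZMod p) with hs
  set E := signMat g r (ZMod p)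
  have hσ : (sigmaMat p S).map (Int.cast : ℤ → ZMod p) =
      fromRows (graphMat s) (0 : Matrix (Fin g) _ _) := by
    have h1 : ((1 : Matrix (Fin g) (Fin g) ℤ).map (Int.cast : ℤ → ZMod p)) = 1 :=
      Matrix.map_one _ Int.cast_zero Int.cast_one
    have hp : (((p : ℤ) • (1 : Matrix (Fin g) (Fin g) ℤ)).map (Int.cast : ℤ → ZMod p)) = 0 := by
      ext i j
      rw [map_apply, Matrix.smul_apply, one_apply]
      split_ifs <;> simp
    rw [sigmaMat, fromBlocks_map, h1, hp, Matrix.map_zero _ Int.cast_zero,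
      ← fromRows_fromCols_eq_fromBlocks, fromCols_zero, graphMat]
  have hW : rowSpace p (sigmaMat p S) =
      Submodule.span (ZMod p) (Set.range (graphMat s).row) := by
    rw [rowSpace, hσ]
    have : Set.range (fromRows (graphMat s) (0 : Matrix (Fin g) _ _)).row =
        Set.range (graphMat s).row ∪ Set.range (0 : Matrix (Fin g) (Fin g ⊕ Fin g) (ZMod p)).row :=
      Set.Sum.elim_range _ _
    rw [this, Submodule.span_union, sup_eq_left, Submodule.span_le]
    rintro _ ⟨i, rfl⟩
    exact zero_mem _
  have hWI : (rowSpace p (sigmaMat p S)).map (sqrtAction g r Δ p) =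
      Submodule.span (ZMod p) (Set.range (graphMat s * sqrtMat g r Δ (ZMod p)).row) := by
    rw [hW, Submodule.map_span, ← Set.range_comp]
    rfl
  have hsum : rowSpace p (sigmaMat p S) ⊔ (rowSpace p (sigmaMat p S)).map (sqrtAction g r Δ p) =
      LinearMap.range (fromBlocks 1 s (-((Δ : ZMod p) • (s * E))) E).vecMulLinear := by
    rw [hWI, hW, graphMat_mul_sqrtMat, ← Submodule.span_union, range_vecMulLinear,
      ← fromRows_fromCols_eq_fromBlocks]
    congr 1
    exact (Set.Sum.elim_range _ _).symm
  have hT : (TMatMod r Δ p S).det = (fromBlocks 1 s (-((Δ : ZMod p) • (s * E))) E).det := by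
    rw [det_fromBlocks_one₁₁, TMatMod_eq, hermMat]
    simp [E, s]
  have hcard : Module.finrank (ZMod p) (Fin g ⊕ Fin g → ZMod p) = 2 * g := by
    simp [two_mul]
  rw [InStratum, isUnit_iff_isUnit_det, hT, ← isUnit_iff_isUnit_det,
    ← vecMul_surjective_iff_isUnit, hsum]
  rw [← hcard]
  constructor
  · intro h
    exact LinearMap.range_eq_top.1 (Submodule.eq_top_of_finrank_eq h)
  · intro h
    rw [LinearMap.range_eq_top.2 h, finrank_top]

end Stratum

/-! ### Unitary similitudes from congruences of T -/

section Unitary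

variable {g : ℕ} {R : Type*} [CommRing R]

/-- `α(GU(r,s)(R))` is the centralizer of `α(√-Δ)` in `GSp_{2g}(R)`. -/
theorem mem_GUimage_of_comm {r Δ : ℕ} {x : GSp g R}
    (hx : x.1.1 * sqrtMat g r Δ R = sqrtMat g r Δ R * x.1.1) : x ∈ GUimage g r Δ R := by
  obtain ⟨x, c, hc⟩ := x
  change x.1 * sqrtMat g r Δ R = sqrtMat g r Δ R * x.1 at hx
  obtain ⟨a, b, a', b', hX⟩ : ∃ a b a' b', x.1 = fromBlocks a b a' b' :=
    ⟨_, _, _, _, (fromBlocks_toBlocks x.1).symm⟩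
  rw [hX, sqrtMat_eq, fromBlocks_multiply, fromBlocks_multiply, fromBlocks_inj] at hx
  obtain ⟨h1, h2, -, -⟩ := hx
  simp at h1 h2
  have e1 : a' = -((Δ : R) • (signMat g r R * b * signMat g r R)) := by
    rw [← signMat_mul_signMat_mul r a', ← h1]
    simp [Matrix.mul_assoc]
  have e2 : b' = signMat g r R * a * signMat g r R := by
    rw [Matrix.mul_assoc, h2, signMat_mul_signMat_mul]
  have hα : x.1 = alphaMat r Δ a (b * signMat g r R) := by
    rw [hX, alphaMat, e1, e2, Matrix.mul_assoc, Matrix.mul_assoc b, signMat_mul_self,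
      Matrix.mul_one]
  refine ⟨a, b * signMat g r R, ⟨⟨c, ?_⟩, ?_⟩, hα⟩
  all_goals
    rw [hX, J, fromBlocks_transpose, fromBlocks_multiply, fromBlocks_multiply, fromBlocks_smul,
      fromBlocks_inj] at hc
    obtain ⟨h3, h4, -, -⟩ := hc
    simp only [e1, e2] at h3 h4
    simp [Matrix.mul_assoc] at h3 h4
  · have h5 := congrArg (· * signMat g r R) h4
    simp [Matrix.add_mul, Matrix.mul_assoc] at h5
    simp only [transpose_mul, signMat_transpose, Matrix.mul_assoc, signMat_mul_signMat_mul]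
    have h6 := congrArg (-·) h5
    simp at h6
    rw [← h6, add_comm]
  · simp only [transpose_mul, signMat_transpose, Matrix.mul_assoc, signMat_mul_signMat_mul]
    rwa [add_neg_eq_zero] at h3

/-- The matrix with rows `(E_g, S)` and `√-Δ (E_g, S)`. -/
def frameMat (r Δ : ℕ) (S : Matrix (Fin g) (Fin g) R) :
    Matrix (Fin g ⊕ Fin g) (Fin g ⊕ Fin g) R :=
  fromBlocks 1 S (-((Δ : R) • (S * signMat g r R))) (signMat g r R)

theorem det_frameMat (r Δ : ℕ) (S : Matrix (Fin g) (Fin g) R) :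
    (frameMat r Δ S).det = (hermMat r Δ S).det := by
  rw [frameMat, det_fromBlocks_one₁₁, hermMat]
  simp

theorem frameMat_mul_sqrtMat (r Δ : ℕ) (S : Matrix (Fin g) (Fin g) R) :
    frameMat r Δ S * sqrtMat g r Δ R = fromBlocks 0 1 (-((Δ : R) • 1)) 0 * frameMat r Δ S := by
  rw [frameMat, sqrtMat_eq, fromBlocks_multiply, fromBlocks_multiply]
  simp [Matrix.mul_assoc]

/-- The diagonal blocks vanish because S is symmetric, so the graph and its image under √-Δ are
isotropic. Thus T alone determines the symplectic form in the frame. -/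
theorem frameMat_mul_J (r Δ : ℕ) {S : Matrix (Fin g) (Fin g) R} (hS : S.IsSymm) :
    frameMat r Δ S * J (Fin g) R * (frameMat r Δ S)ᵀ =
      fromBlocks 0 (-hermMat r Δ S) (hermMat r Δ S) 0 := by
  rw [frameMat, J, fromBlocks_transpose, fromBlocks_multiply, fromBlocks_multiply, hermMat]
  simp [Matrix.mul_assoc, hS.eq]

/-- IsCongruent Hermitian forms come from the same orbit of the unitary similitude group. -/
theorem exists_GUimage_graphMat (r Δ : ℕ) {S₁ S₂ : Matrix (Fin g) (Fin g) R} (h₁ : S₁.IsSymm)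
    (h₂ : S₂.IsSymm) (hT₁ : IsUnit (hermMat r Δ S₁).det)
    {c : R} (hc : IsUnit c) (hcong : IsCongruent (c • hermMat r Δ S₂) (hermMat r Δ S₁)) :
    ∃ u ∈ GUimage g r Δ R, ∃ P : Matrix (Fin g) (Fin g) R,
      graphMat S₁ * u.1.1 = P * graphMat S₂ := by
  obtain ⟨P, -, hP⟩ := hcong
  set Q₁ := frameMat r Δ S₁ with hQ₁
  set Q₂ := frameMat r Δ S₂ with hQ₂
  -- The similitude sought is u = Q₁⁻¹ D Q₂. Using the same P on both halves of the frame makes D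
  -- commute with K, the matrix of √-Δ in either frame, so that u is linear over √-Δ.
  set D := fromBlocks P 0 0 P with hD
  set K : Matrix (Fin g ⊕ Fin g) (Fin g ⊕ Fin g) R := fromBlocks 0 1 (-((Δ : R) • 1)) 0 with hK
  have hu : IsUnit Q₁.det := by rwa [hQ₁, det_frameMat]
  have hu' : IsUnit Q₁ᵀ.det := by rwa [det_transpose]
  obtain ⟨c, rfl⟩ := hc
  have hDK : D * K = K * D := by
    rw [hD, hK, fromBlocks_multiply, fromBlocks_multiply]
    simp
  have hJ : Q₁⁻¹ * (Q₁ * J (Fin g) R * Q₁ᵀ) * (Q₁⁻¹)ᵀ = J (Fin g) R := by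
    rw [transpose_nonsing_inv, Matrix.mul_assoc Q₁, nonsing_inv_mul_cancel_left _ _ hu,
      mul_nonsing_inv_cancel_right _ _ hu']
  have hsim : (Q₁⁻¹ * (D * Q₂)) * J (Fin g) R * (Q₁⁻¹ * (D * Q₂))ᵀ
      = ((c⁻¹ : Rˣ) : R) • J (Fin g) R := by
    have e : D * (Q₂ * J (Fin g) R * Q₂ᵀ) * Dᵀ
        = ((c⁻¹ : Rˣ) : R) • (Q₁ * J (Fin g) R * Q₁ᵀ) := by
      rw [hQ₁, hQ₂, frameMat_mul_J r Δ h₁, frameMat_mul_J r Δ h₂, ← hP, hD, fromBlocks_transpose,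
        fromBlocks_multiply, fromBlocks_multiply, fromBlocks_smul]
      simp [smul_smul]
    conv_rhs => rw [← hJ, ← Matrix.smul_mul, ← Matrix.mul_smul, ← e]
    simp only [transpose_mul, Matrix.mul_assoc]
  obtain ⟨u, hux⟩ := GSp.exists_val_eq (c⁻¹).isUnit hsim
  have hQu : Q₁ * u.1.1 = D * Q₂ := by rw [hux, mul_nonsing_inv_cancel_left _ _ hu]
  refine ⟨u, mem_GUimage_of_comm ?_, P, ?_⟩
  · have h3 : Q₁ * (u.1.1 * sqrtMat g r Δ R) = Q₁ * (sqrtMat g r Δ R * u.1.1) := by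
      rw [← Matrix.mul_assoc, hQu, ← Matrix.mul_assoc, hQ₁, frameMat_mul_sqrtMat, ← hQ₁, ← hK,
        Matrix.mul_assoc K, hQu, Matrix.mul_assoc D, hQ₂, frameMat_mul_sqrtMat, ← hQ₂, ← hK,
        ← Matrix.mul_assoc D, hDK, Matrix.mul_assoc]
    have h4 := congrArg (Q₁⁻¹ * ·) h3
    simpa only [nonsing_inv_mul_cancel_left _ _ hu] using h4
  · obtain ⟨a, b, a', b', hX⟩ : ∃ a b a' b', u.1.1 = fromBlocks a b a' b' :=
      ⟨_, _, _, _, (fromBlocks_toBlocks u.1.1).symm⟩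
    rw [hX, hQ₁, hQ₂, frameMat, frameMat, hD, fromBlocks_multiply, fromBlocks_multiply,
      fromBlocks_inj] at hQu
    rw [hX, graphMat, graphMat, fromCols_mul_fromBlocks, mul_fromCols, hQu.1, hQu.2.1]
    simp

end Unitary

/-! ### Integral unitary similitudes between cosets at p -/

section Local

variable {g : ℕ} {p : Nat.Primes}

theorem intCast_map_padic (S : Matrix (Fin g) (Fin g) ℤ) :
    (S.map (Int.cast : ℤ → ℤ_[p])).map (algebraMap ℤ_[p] ℚ_[p])
      = S.map (Int.cast : ℤ → ℚ_[p]) := by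
  ext; simp

theorem sigma_val (S : Matrix (Fin g) (Fin g) ℤ) (hS : S.IsSymm) :
    (sigma p S hS).1.1 = (fromBlocks 1 (S.map (Int.cast : ℤ → ℤ_[p])) 0
      (((p : ℕ) : ℤ_[p]) • 1)).map (algebraMap ℤ_[p] ℚ_[p]) := by
  have h1 : (sigma p S hS).1.1 = (sigmaMat (p : ℕ) S).map (Int.cast : ℤ → ℚ_[p]) := rfl
  rw [h1, sigmaMat, fromBlocks_map, fromBlocks_map, intCast_map_padic,
    Matrix.map_one _ Int.cast_zero Int.cast_one, Matrix.map_one _ (map_zero _) (map_one _),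
    Matrix.map_zero _ Int.cast_zero, Matrix.map_zero _ (map_zero _)]
  congr 1
  ext i j
  simp only [Matrix.map_apply, Matrix.smul_apply, one_apply]
  split_ifs <;> simp

/-- If `u ∈ GSp_{2g}(ℤ_p)` maps the graph of `S₁` to the graph of `S₂`, then `σ(S₁) u` and `σ(S₂)`
define the same coset of `GSp_{2g}(ℤ_p)`. -/
theorem exists_GSpInt_of_graphMat {S₁ S₂ : Matrix (Fin g) (Fin g) ℤ} (h₁ : S₁.IsSymm)
    (h₂ : S₂.IsSymm) {u : GSp g ℤ_[p]} {P : Matrix (Fin g) (Fin g) ℤ_[p]}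
    (h : graphMat (S₁.map (Int.cast : ℤ → ℤ_[p])) * u.1.1
      = P * graphMat (S₂.map (Int.cast : ℤ → ℤ_[p]))) :
    ∃ m ∈ GSpInt g p, sigma p S₁ h₁ * GSp.map (algebraMap ℤ_[p] ℚ_[p]) u
      = m * sigma p S₂ h₂ := by
  set s₁ := S₁.map (Int.cast : ℤ → ℤ_[p])
  set s₂ := S₂.map (Int.cast : ℤ → ℤ_[p])
  have hs₁ : s₁.IsSymm := h₁.map _
  have hs₂ : s₂.IsSymm := h₂.map _
  have hp : ((p : ℕ) : ℤ_[p]) ≠ 0 := by exact_mod_cast p.2.ne_zero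
  obtain ⟨⟨u, c, hc⟩, hu⟩ : ∃ v, v = u := ⟨u, rfl⟩
  rw [← hu] at h ⊢
  change graphMat s₁ * u.1 = P * graphMat s₂ at h
  obtain ⟨a, b, a', b', hX⟩ : ∃ a b a' b', u.1 = fromBlocks a b a' b' :=
    ⟨_, _, _, _, (fromBlocks_toBlocks u.1).symm⟩
  have hσJ : ∀ s : Matrix (Fin g) (Fin g) ℤ_[p], s.IsSymm →
      fromBlocks 1 s 0 (((p : ℕ) : ℤ_[p]) • 1) * J (Fin g) ℤ_[p] *
        (fromBlocks 1 s 0 (((p : ℕ) : ℤ_[p]) • 1))ᵀ = ((p : ℕ) : ℤ_[p]) • J (Fin g) ℤ_[p] := by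
    intro s hs
    rw [J, fromBlocks_transpose, fromBlocks_multiply, fromBlocks_multiply, fromBlocks_smul]
    congr 1 <;> simp [hs.eq]
  obtain ⟨M, hM⟩ : ∃ M, M * fromBlocks 1 s₂ 0 (((p : ℕ) : ℤ_[p]) • 1)
      = fromBlocks 1 s₁ 0 (((p : ℕ) : ℤ_[p]) • 1) * u.1 := by
    -- This is σ(S₁) u σ(S₂)⁻¹. Its upper rows come from the graph condition; in the lower right
    -- block the factor p of σ(S₁) cancels that of σ(S₂)⁻¹, so the matrix is integral.
    refine ⟨fromBlocks P 0 (((p : ℕ) : ℤ_[p]) • a') (b' - a' * s₂), ?_⟩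
    rw [hX, graphMat, graphMat, fromCols_mul_fromBlocks, mul_fromCols] at h
    obtain ⟨e1, e2⟩ := fromCols_inj h
    rw [hX, fromBlocks_multiply, fromBlocks_multiply, e1, e2]
    congr 1 <;> simp [smul_sub]
  -- Both σ's have multiplier p, which cancels and leaves the unit multiplier of u.
  have hMJ : M * J (Fin g) ℤ_[p] * Mᵀ = (c : ℤ_[p]) • J (Fin g) ℤ_[p] := by
    have e := congrArg (fun X => X * J (Fin g) ℤ_[p] * Xᵀ) hM
    have e1 : ∀ A B C : Matrix (Fin g ⊕ Fin g) (Fin g ⊕ Fin g) ℤ_[p],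
        (A * B) * C * (A * B)ᵀ = A * (B * C * Bᵀ) * Aᵀ := by
      intro A B C
      simp only [transpose_mul, Matrix.mul_assoc]
    simp only [e1, hσJ _ hs₂, hc, Matrix.mul_smul, Matrix.smul_mul, hσJ _ hs₁] at e
    rw [smul_comm] at e
    exact smul_right_injective _ hp e
  obtain ⟨m, hm⟩ := GSp.exists_val_eq c.isUnit hMJ
  refine ⟨_, ⟨m, rfl⟩, GSp.ext_val ?_⟩
  rw [GSp.val_mul, GSp.val_mul, sigma_val, sigma_val, GSp.val_map, GSp.val_map, hm,
    ← Matrix.map_mul, ← Matrix.map_mul, hM]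

/-- A sufficient condition for `σ(S₁)` and `σ(S₂)` to lie in the same orbit of the unitary group. -/
theorem exists_unitary_of_det (hg : 0 < g) (r Δ : ℕ) (hp2 : (p : ℕ) ≠ 2)
    {S₁ S₂ : Matrix (Fin g) (Fin g) ℤ} (h₁ : S₁.IsSymm) (h₂ : S₂.IsSymm)
    (hT₁ : IsUnit (TMatMod r Δ p S₁)) (hT₂ : IsUnit (TMatMod r Δ p S₂))
    (h : Odd g ∨ IsSquare ((TMatMod r Δ p S₁).det / (TMatMod r Δ p S₂).det)) :
    ∃ u ∈ GSpInt g p, u ∈ GUimage g r Δ ℚ_[p] ∧ ∃ m ∈ GSpInt g p,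
      sigma p S₁ h₁ * u = m * sigma p S₂ h₂ := by
  have : Nonempty (Fin g) := ⟨⟨0, hg⟩⟩
  set s₁ := S₁.map (Int.cast : ℤ → ℤ_[p]) with hs₁
  set s₂ := S₂.map (Int.cast : ℤ → ℤ_[p]) with hs₂
  have hred : ∀ S : Matrix (Fin g) (Fin g) ℤ, PadicInt.toZMod
      (hermMat r Δ (S.map (Int.cast : ℤ → ℤ_[p]))).det = (TMatMod r Δ p S).det := by
    intro S
    rw [RingHom.map_det, RingHom.mapMatrix_apply, hermMat_map, TMatMod_eq]
    congr 2
    ext; simp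
  rw [isUnit_iff_isUnit_det] at hT₁ hT₂
  have hu₁ : IsUnit (hermMat r Δ s₁).det := by
    rw [isUnit_iff_toZMod_ne_zero, hred]; exact hT₁.ne_zero
  have hu₂ : IsUnit (hermMat r Δ s₂).det := by
    rw [isUnit_iff_toZMod_ne_zero, hred]; exact hT₂.ne_zero
  obtain ⟨c, hc, hcong⟩ : ∃ c : ℤ_[p], IsUnit c ∧
      Matrix.IsCongruent (c • hermMat r Δ s₂) (hermMat r Δ s₁) := by
    have hsym₁ := hermMat_isSymm r Δ (h₁.map (Int.cast : ℤ → ℤ_[p]))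
    have hsym₂ := hermMat_isSymm r Δ (h₂.map (Int.cast : ℤ → ℤ_[p]))
    rcases h with hodd | hsq
    -- Take c = det T₁ det T₂: then det(c T₂) det T₁ = c^(g+1), a square as g + 1 is even.
    · refine ⟨_, hu₁.mul hu₂, congruent_of_isSquare hp2 (hsym₂.smul _) hsym₁ ?_ hu₁ ?_⟩
      · rw [det_smul]
        exact ((hu₁.mul hu₂).pow _).mul hu₂
      · rw [det_smul, Fintype.card_fin, mul_assoc, mul_comm (hermMat r Δ s₂).det, ← pow_succ]
        exact (hodd.add_one.isSquare_pow _).map _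
    · refine ⟨1, isUnit_one, ?_⟩
      rw [one_smul]
      refine congruent_of_isSquare hp2 hsym₂ hsym₁ hu₂ hu₁ ?_
      rw [map_mul, hred, hred]
      have := hsq.mul (IsSquare.mul_self (TMatMod r Δ p S₂).det)
      rwa [← mul_assoc, div_mul_cancel₀ _ hT₂.ne_zero, mul_comm] at this
  obtain ⟨u, hu, P, hP⟩ := exists_GUimage_graphMat r Δ (h₁.map _) (h₂.map _) hu₁ hc hcong
  refine ⟨_, ⟨u, rfl⟩, mem_GUimage_of_comm ?_, exists_GSpInt_of_graphMat h₁ h₂ hP⟩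
  rw [GSp.val_map, ← sqrtMat_map r Δ (algebraMap ℤ_[p] ℚ_[p]), ← Matrix.map_mul, ← Matrix.map_mul,
    GUimage_comm_sqrtMat hu]

end Local

/-! ### Hyperbolic rotations in planes of signature (1, 1) -/

section Boost

variable {g : ℕ}

theorem mul_single_one_apply (A : Matrix (Fin g) (Fin g) ℝ) (i j k l : Fin g) :
    (A * (Matrix.single i j 1 : Matrix (Fin g) (Fin g) ℝ)) k l = if l = j then A k i else 0 := by
  simp [mul_apply, single_apply, ite_and, eq_comm]

theorem single_one_mul_apply (A : Matrix (Fin g) (Fin g) ℝ) (i j k l : Fin g) :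
    ((Matrix.single i j 1 : Matrix (Fin g) (Fin g) ℝ) * A) k l = if k = i then A j l else 0 := by
  simp [mul_apply, single_apply, ite_and, eq_comm]

/-- The projection to the coordinate plane of `i` and `j`. -/
def planeProj (i j : Fin g) : Matrix (Fin g) (Fin g) ℝ :=
  Matrix.single i i 1 + Matrix.single j j 1

/-- The exchange of the coordinates `i` and `j` on their coordinate plane. -/
def planeSwap (i j : Fin g) : Matrix (Fin g) (Fin g) ℝ :=
  Matrix.single i j 1 + Matrix.single j i 1

/-- Commuting with the projection kills the entries between {i, j} and other indices; commuting with
the swap gives A i j = A j i, which is zero by skewness. Since both signs occur, every off-diagonal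
entry is reached by some pair of opposite signs. -/
theorem eq_zero_of_comm_plane {r : ℕ} (hr : 0 < r) (hrg : r < g) {A : Matrix (Fin g) (Fin g) ℝ}
    (hA : Aᵀ = -A)
    (h : ∀ i j : Fin g, (i : ℕ) < r → r ≤ (j : ℕ) →
      A * planeProj i j = planeProj i j * A ∧ A * planeSwap i j = planeSwap i j * A) : A = 0 := by
  have hA' : ∀ i j, A j i = - A i j := fun i j => by
    have := congrFun (congrFun hA i) j
    simpa using this
  have key : ∀ i j : Fin g, (i : ℕ) < r → r ≤ (j : ℕ) →
      A i j = 0 ∧ ∀ k, k ≠ i → k ≠ j → A k i = 0 ∧ A k j = 0 := by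
    intro i j hi hj
    have hij : i ≠ j := by rintro rfl; omega
    obtain ⟨h1, h2⟩ := h i j hi hj
    refine ⟨?_, fun k hki hkj => ⟨?_, ?_⟩⟩
    · have := congrFun (congrFun h2 i) i
      simp [planeSwap, Matrix.mul_add, Matrix.add_mul, hij] at this
      have := hA' i j
      linarith
    · have := congrFun (congrFun h1 k) i
      simpa [planeProj, Matrix.mul_add, Matrix.add_mul, mul_single_one_apply, single_one_mul_apply,
        hij, hij.symm, hki, hkj] using this
    · have := congrFun (congrFun h1 k) j
      simpa [planeProj, Matrix.mul_add, Matrix.add_mul, mul_single_one_apply, single_one_mul_apply,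
        hij, hij.symm, hki, hkj] using this
  ext k l
  rw [Matrix.zero_apply]
  by_cases hkl : k = l
  · subst hkl
    have := hA' k k
    linarith
  · by_cases hl : (l : ℕ) < r
    · by_cases hk : (k : ℕ) < r
      · exact ((key l ⟨r, hrg⟩ hl le_rfl).2 k hkl (by rintro rfl; simp at hk)).1
      · rw [hA' l k, (key l k hl (not_lt.1 hk)).1, neg_zero]
    · by_cases hk : (k : ℕ) < r
      · exact (key k l hk (not_lt.1 hl)).1
      · exact ((key ⟨0, by omega⟩ l hr (not_lt.1 hl)).2 k
          (by intro e; rw [e] at hk; exact hk hr) hkl).2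

/-- As in the skew case the off-diagonal entries vanish. Anticommuting with the swap gives B j j =
-B i i for all i, j of opposite signs, so the diagonal is proportional to that of E. -/
theorem eq_smul_signMat_of_comm_plane {r : ℕ} (hr : 0 < r) (hrg : r < g)
    {B : Matrix (Fin g) (Fin g) ℝ} (hB : Bᵀ = B)
    (h : ∀ i j : Fin g, (i : ℕ) < r → r ≤ (j : ℕ) →
      B * planeProj i j = planeProj i j * B ∧ B * planeSwap i j = -(planeSwap i j * B)) :
    ∃ b : ℝ, B = b • signMat g r ℝ := by
  have hB' : ∀ i j, B j i = B i j := fun i j => congrFun (congrFun hB i) j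
  have key : ∀ i j : Fin g, (i : ℕ) < r → r ≤ (j : ℕ) →
      B i j = 0 ∧ B j j = - B i i ∧ ∀ k, k ≠ i → k ≠ j → B k i = 0 ∧ B k j = 0 := by
    intro i j hi hj
    have hij : i ≠ j := by rintro rfl; omega
    obtain ⟨h1, h2⟩ := h i j hi hj
    refine ⟨?_, ?_, fun k hki hkj => ⟨?_, ?_⟩⟩
    · have := congrFun (congrFun h2 i) i
      simp [planeSwap, Matrix.mul_add, Matrix.add_mul, hij] at this
      have := hB' i j
      linarith
    · have := congrFun (congrFun h2 i) j
      simp [planeSwap, Matrix.mul_add, Matrix.add_mul, hij, hij.symm] at this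
      linarith
    · have := congrFun (congrFun h1 k) i
      simpa [planeProj, Matrix.mul_add, Matrix.add_mul, mul_single_one_apply, single_one_mul_apply,
        hij, hij.symm, hki, hkj] using this
    · have := congrFun (congrFun h1 k) j
      simpa [planeProj, Matrix.mul_add, Matrix.add_mul, mul_single_one_apply, single_one_mul_apply,
        hij, hij.symm, hki, hkj] using this
  set i₀ : Fin g := ⟨0, by omega⟩ with hi₀
  set j₀ : Fin g := ⟨r, hrg⟩ with hj₀
  refine ⟨B i₀ i₀, ?_⟩
  ext k l
  rw [Matrix.smul_apply, signMat, diagonal_apply]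
  by_cases hkl : k = l
  · subst hkl
    by_cases hk : (k : ℕ) < r
    · have h1 := (key k j₀ hk le_rfl).2.1
      have h2 := (key i₀ j₀ hr le_rfl).2.1
      simp [hk]
      linarith
    · have h1 := (key i₀ k hr (not_lt.1 hk)).2.1
      simp [hk, h1]
  · rw [if_neg hkl, smul_zero]
    by_cases hl : (l : ℕ) < r
    · by_cases hk : (k : ℕ) < r
      · exact ((key l j₀ hl le_rfl).2.2 k hkl (by rintro rfl; simp [hj₀] at hk)).1
      · rw [hB' l k, (key l k hl (not_lt.1 hk)).1]
    · by_cases hk : (k : ℕ) < r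
      · exact (key k l hk (not_lt.1 hl)).1
      · exact ((key i₀ l hr (not_lt.1 hl)).2.2 k
          (by rintro rfl; simp [hi₀] at hk; omega) hkl).2

theorem planeProj_mul_self {i j : Fin g} (hij : i ≠ j) :
    planeProj i j * planeProj i j = planeProj i j := by
  simp [planeProj, Matrix.mul_add, Matrix.add_mul, hij, hij.symm]

theorem planeSwap_mul_self {i j : Fin g} (hij : i ≠ j) :
    planeSwap i j * planeSwap i j = planeProj i j := by
  simp [planeProj, planeSwap, Matrix.mul_add, Matrix.add_mul, hij, hij.symm, add_comm]

theorem planeProj_mul_planeSwap {i j : Fin g} (hij : i ≠ j) :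
    planeProj i j * planeSwap i j = planeSwap i j := by
  simp [planeProj, planeSwap, Matrix.mul_add, Matrix.add_mul, hij, hij.symm]

theorem planeSwap_mul_planeProj {i j : Fin g} (hij : i ≠ j) :
    planeSwap i j * planeProj i j = planeSwap i j := by
  simp [planeProj, planeSwap, Matrix.mul_add, Matrix.add_mul, hij, hij.symm, add_comm]

theorem signMat_mul_planeProj (r : ℕ) (i j : Fin g) :
    signMat g r ℝ * planeProj i j = planeProj i j * signMat g r ℝ := by
  ext k l
  simp [planeProj, signMat, diagonal_mul, mul_diagonal, single_apply]
  grind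

theorem signMat_mul_planeSwap {r : ℕ} {i j : Fin g} (hi : (i : ℕ) < r) (hj : r ≤ (j : ℕ)) :
    signMat g r ℝ * planeSwap i j = -(planeSwap i j * signMat g r ℝ) := by
  ext k l
  simp [planeSwap, signMat, diagonal_mul, mul_diagonal, single_apply]
  grind

/-- The hyperbolic rotation by `t` in the coordinate plane of `i` and `j`. -/
def boost (i j : Fin g) (t : ℝ) : Matrix (Fin g) (Fin g) ℝ :=
  1 + (Real.cosh t - 1) • planeProj i j + Real.sinh t • planeSwap i j

theorem boost_mul_boost {i j : Fin g} (hij : i ≠ j) (s t : ℝ) :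
    boost i j s * boost i j t = boost i j (s + t) := by
  simp only [boost, Matrix.mul_add, Matrix.add_mul, Matrix.mul_smul, Matrix.smul_mul,
    planeProj_mul_self hij, planeSwap_mul_self hij, planeProj_mul_planeSwap hij,
    planeSwap_mul_planeProj hij, Matrix.one_mul, Matrix.mul_one, Real.cosh_add,
    Real.sinh_add]
  module

theorem boost_zero (i j : Fin g) : boost i j 0 = 1 := by simp [boost]

theorem boost_transpose (i j : Fin g) (t : ℝ) : (boost i j t)ᵀ = boost i j t := by
  simp [boost, planeProj, planeSwap, transpose_add, add_comm]

theorem signMat_mul_boost {r : ℕ} {i j : Fin g} (hi : (i : ℕ) < r) (hj : r ≤ (j : ℕ)) (t : ℝ) :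
    signMat g r ℝ * boost i j t = boost i j (-t) * signMat g r ℝ := by
  simp only [boost, Matrix.mul_add, Matrix.add_mul, Matrix.mul_smul, Matrix.smul_mul,
    signMat_mul_planeProj, signMat_mul_planeSwap hi hj, Real.cosh_neg, Real.sinh_neg]
  simp

theorem continuous_boost (i j : Fin g) : Continuous (boost i j) := by
  unfold boost
  fun_prop

end Boost

/-! ### Complex structures of the unitary domain and their commutant -/

section Generic

variable {g : ℕ}

/-- The matrix `h_V(i)`. -/
def cplxMat (g Δ : ℕ) : Matrix (Fin g ⊕ Fin g) (Fin g ⊕ Fin g) ℝ :=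
  fromBlocks 0 ((√(Δ : ℝ))⁻¹ • 1) (-(√(Δ : ℝ) • 1)) 0

theorem alphaMat_eq_cplxMat (r Δ : ℕ) :
    alphaMat r Δ 0 ((√(Δ : ℝ))⁻¹ • signMat g r ℝ) = cplxMat g Δ := by
  have h : (Δ : ℝ) * (√(Δ : ℝ))⁻¹ = √(Δ : ℝ) := by
    rw [← div_eq_mul_inv, Real.div_sqrt]
  simp [alphaMat, cplxMat, smul_smul, h]

theorem mem_unitaryDomain {r Δ : ℕ}
    {x : Matrix (Fin g ⊕ Fin g) (Fin g ⊕ Fin g) ℝ} : x ∈ unitaryDomain g r Δ ↔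
      ∃ M ∈ GUimage g r Δ ℝ, x = M.1.1 * cplxMat g Δ * (M⁻¹).1.1 := by
  rw [← alphaMat_eq_cplxMat r Δ]
  rfl

/-- The similitude diag(1, √Δ) conjugates the standard complex structure to h_V(i). -/
theorem unitaryDomain_subset {Δ : ℕ} (hΔ : 0 < Δ) (r : ℕ) :
    unitaryDomain g r Δ ⊆ siegelDomain g := by
  intro x hx
  obtain ⟨M, -, rfl⟩ := mem_unitaryDomain.1 hx
  have hδ : √(Δ : ℝ) ≠ 0 := by positivity
  obtain ⟨N, hN⟩ : ∃ N : GSp g ℝ, N.1.1 = fromBlocks 1 0 0 (√(Δ : ℝ) • 1) := by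
    refine GSp.exists_val_eq (isUnit_iff_ne_zero.2 hδ) ?_
    rw [J, fromBlocks_transpose, fromBlocks_multiply, fromBlocks_multiply, fromBlocks_smul]
    simp
  have h : cplxMat g Δ = N.1.1 * fromBlocks 0 1 (-1) 0 * (N⁻¹).1.1 := by
    have h1 : cplxMat g Δ * N.1.1 = N.1.1 * fromBlocks 0 1 (-1) 0 := by
      rw [hN, cplxMat, fromBlocks_multiply, fromBlocks_multiply]
      simp [smul_smul, hδ]
    rw [← h1, Matrix.mul_assoc, GSp.val_mul_inv, Matrix.mul_one]
  refine ⟨M * N, ?_⟩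
  rw [h, _root_.mul_inv_rev, GSp.val_mul, GSp.val_mul]
  simp only [Matrix.mul_assoc]

theorem GSp.conj_comm {R : Type*} [CommRing R] {M : GSp g R}
    {X Y : Matrix (Fin g ⊕ Fin g) (Fin g ⊕ Fin g) R} :
    X * (M.1.1 * Y * (M⁻¹).1.1) = M.1.1 * Y * (M⁻¹).1.1 * X ↔
      (M⁻¹).1.1 * X * M.1.1 * Y = Y * ((M⁻¹).1.1 * X * M.1.1) := by
  constructor
  · intro h
    have := congrArg (fun Z => (M⁻¹).1.1 * Z * M.1.1) h
    simp only [Matrix.mul_assoc, GSp.val_inv_mul, Matrix.mul_one] at this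
    simp only [← Matrix.mul_assoc, GSp.val_inv_mul, Matrix.one_mul] at this
    simpa only [Matrix.mul_assoc] using this
  · intro h
    have := congrArg (fun Z => M.1.1 * Z * (M⁻¹).1.1) h
    simp only [Matrix.mul_assoc, GSp.val_mul_inv, Matrix.mul_one] at this
    simp only [← Matrix.mul_assoc, GSp.val_mul_inv, Matrix.one_mul] at this
    simpa only [Matrix.mul_assoc] using this

theorem unitaryDomain_comm {r Δ : ℕ} {x : Matrix (Fin g ⊕ Fin g) (Fin g ⊕ Fin g) ℝ}
    (hx : x ∈ unitaryDomain g r Δ) : x * sqrtMat g r Δ ℝ = sqrtMat g r Δ ℝ * x := by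
  obtain ⟨M, hM, rfl⟩ := hx
  have h := GUimage_comm_sqrtMat hM
  rw [eq_comm, GSp.conj_comm, Matrix.mul_assoc _ _ M.1.1, ← h, ← Matrix.mul_assoc,
    GSp.val_inv_mul, Matrix.one_mul, alphaMat_comm_sqrtMat]

/-- A `J`-skew complex structure that commutes with sufficiently many points of the symmetric
domain of the unitary group is `±√-Δ`. -/
theorem eq_sqrtMat_of_comm {r Δ : ℕ} (hΔ : 0 < Δ) (hr : 0 < r) (hrg : r < g)
    {X : Matrix (Fin g ⊕ Fin g) (Fin g ⊕ Fin g) ℝ} (hX : X * X = -((Δ : ℝ) • 1))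
    (hJ : (X * J (Fin g) ℝ).IsSymm) (h0 : X * cplxMat g Δ = cplxMat g Δ * X)
    (h : ∀ i j : Fin g, (i : ℕ) < r → r ≤ (j : ℕ) → ∃ t ≠ 0, ∀ s, s = t ∨ s = -t →
      X * fromBlocks 0 ((√(Δ : ℝ))⁻¹ • boost i j s) (-(√(Δ : ℝ) • boost i j (-s))) 0 =
        fromBlocks 0 ((√(Δ : ℝ))⁻¹ • boost i j s) (-(√(Δ : ℝ) • boost i j (-s))) 0 * X) :
    ∃ e : ℤˣ, X = (e : ℤ) • sqrtMat g r Δ ℝ := by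
  obtain ⟨A, B, C, F, rfl⟩ : ∃ A B C F, X = fromBlocks A B C F :=
    ⟨_, _, _, _, (fromBlocks_toBlocks _).symm⟩
  set δ := √(Δ : ℝ) with hδdef
  have hδ : δ ≠ 0 := by positivity
  have hδ2 : δ * δ = Δ := Real.mul_self_sqrt (by positivity)
  rw [cplxMat, ← hδdef, fromBlocks_multiply, fromBlocks_multiply, fromBlocks_inj] at h0
  simp at h0
  obtain ⟨h01, h02, h03, h04⟩ := h0
  have hF : F = A := by
    have := congrArg (δ • ·) h02
    simpa [smul_smul, hδ, eq_comm] using this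
  have hC : C = -((Δ : ℝ) • B) := by
    have := congrArg (δ • ·) h01
    simp only [smul_neg, smul_smul, hδ2, mul_inv_cancel₀ hδ, one_smul] at this
    exact this.symm
  subst hF hC
  rw [J, fromBlocks_multiply] at hJ
  simp at hJ
  rw [isSymm_fromBlocks_iff] at hJ
  obtain ⟨hB, hF', -, -⟩ := hJ
  simp at hF'
  -- By now X has the blocks F, B, -ΔB, F with F skew and B symmetric. The sums and differences of
  -- the relations at t and -t separate the even part (cosh t - 1) `planeProj` of the boost from its
  -- odd part sinh t `planeSwap`.
  have hcomm : ∀ i j : Fin g, (i : ℕ) < r → r ≤ (j : ℕ) →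
      (F * planeProj i j = planeProj i j * F ∧ F * planeSwap i j = planeSwap i j * F) ∧
      B * planeProj i j = planeProj i j * B ∧ B * planeSwap i j = -(planeSwap i j * B) := by
    intro i j hi hj
    obtain ⟨t, ht, hs⟩ := h i j hi hj
    have hs' : ∀ s, s = t ∨ s = -t → F * boost i j s = boost i j s * F ∧
        B * boost i j (-s) = boost i j s * B := by
      intro s hst
      have h1 := hs s hst
      rw [fromBlocks_multiply, fromBlocks_multiply, fromBlocks_inj] at h1
      simp at h1
      obtain ⟨h11, h12, -, -⟩ := h1
      constructor
      · have := congrArg (δ • ·) h12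
        simpa [smul_smul, hδ] using this
      · have := congrArg (δ⁻¹ • ·) h11
        simp only [smul_smul, ← hδ2, inv_mul_cancel₀ hδ, one_smul, ← mul_assoc] at this
        have e : δ⁻¹ * δ * δ * δ⁻¹ = 1 := by field_simp
        simpa [smul_smul, hδ, e] using this
    obtain ⟨a1, b1⟩ := hs' t (.inl rfl)
    obtain ⟨a2, b2⟩ := hs' (-t) (.inr rfl)
    rw [neg_neg] at b2
    have hc : Real.cosh t - 1 ≠ 0 := (sub_pos.2 (Real.one_lt_cosh.2 ht)).ne'
    have hsh : Real.sinh t ≠ 0 := Real.sinh_ne_zero.2 ht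
    simp only [boost, Real.cosh_neg, Real.sinh_neg, Matrix.mul_add, Matrix.add_mul, Matrix.mul_one,
      Matrix.one_mul, Matrix.mul_smul, Matrix.smul_mul] at a1 a2 b1 b2
    refine ⟨⟨?_, ?_⟩, ?_, ?_⟩
    · refine smul_right_injective _ hc (?_ : _ • _ = _ • _)
      linear_combination (norm := module) (1 / 2 : ℝ) • a1 + (1 / 2 : ℝ) • a2
    · refine smul_right_injective _ hsh (?_ : _ • _ = _ • _)
      linear_combination (norm := module) (1 / 2 : ℝ) • a1 - (1 / 2 : ℝ) • a2
    · refine smul_right_injective _ hc (?_ : _ • _ = _ • _)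
      linear_combination (norm := module) (1 / 2 : ℝ) • b1 + (1 / 2 : ℝ) • b2
    · refine smul_right_injective _ hsh (?_ : _ • _ = _ • _)
      linear_combination (norm := module) (1 / 2 : ℝ) • b2 - (1 / 2 : ℝ) • b1
  have hF0 : F = 0 := eq_zero_of_comm_plane hr hrg (neg_eq_iff_eq_neg.1 hF') fun i j hi hj =>
    (hcomm i j hi hj).1
  obtain ⟨b, rfl⟩ := eq_smul_signMat_of_comm_plane hr hrg hB fun i j hi hj => (hcomm i j hi hj).2
  have hXb : fromBlocks F (b • signMat g r ℝ) (-((Δ : ℝ) • b • signMat g r ℝ)) F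
      = b • sqrtMat g r Δ ℝ := by
    rw [sqrtMat_eq, fromBlocks_smul, hF0, smul_zero, smul_neg, smul_comm]
  rw [hXb] at hX ⊢
  rw [Matrix.smul_mul, Matrix.mul_smul, sqrtMat_mul_self] at hX
  have hb : b * b = 1 := by
    have := congrFun (congrFun hX (.inl ⟨0, by omega⟩)) (.inl ⟨0, by omega⟩)
    have hΔ' : (Δ : ℝ) ≠ 0 := by positivity
    simp at this
    field_simp at this
    linarith
  rcases mul_self_eq_one_iff.1 hb with rfl | rfl
  · exact ⟨1, by simp⟩
  · exact ⟨-1, by simp⟩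

end Generic

/-! ### A generic point of the unitary domain -/

section Baire

variable {g : ℕ}

/-- The unitary group `U(r,s)(ℝ)`, as a set of pairs `(h, k)`. -/
def unitarySet (g r Δ : ℕ) : Set (Matrix (Fin g) (Fin g) ℝ × Matrix (Fin g) (Fin g) ℝ) :=
  {q | q.1 * signMat g r ℝ * q.1ᵀ + (Δ : ℝ) • (q.2 * signMat g r ℝ * q.2ᵀ) = signMat g r ℝ ∧
    q.2 * signMat g r ℝ * q.1ᵀ = q.1 * signMat g r ℝ * q.2ᵀ}

theorem isClosed_unitarySet (r Δ : ℕ) : IsClosed (unitarySet g r Δ) := by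
  refine IsClosed.inter (isClosed_eq ?_ ?_) (isClosed_eq ?_ ?_) <;> fun_prop

instance baireSpace_unitarySet (r Δ : ℕ) : BaireSpace (unitarySet g r Δ) := by
  have : LocallyCompactSpace (Matrix (Fin g) (Fin g) ℝ) :=
    inferInstanceAs (LocallyCompactSpace (Fin g → Fin g → ℝ))
  have : LocallyCompactSpace (unitarySet g r Δ) :=
    (isClosed_unitarySet r Δ).isClosedEmbedding_subtypeVal.locallyCompactSpace
  infer_instance

/-- The point of the symmetric domain that corresponds to an element of the unitary group. -/
def unitaryPoint (r Δ : ℕ) (q : Matrix (Fin g) (Fin g) ℝ × Matrix (Fin g) (Fin g) ℝ) :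
    Matrix (Fin g ⊕ Fin g) (Fin g ⊕ Fin g) ℝ :=
  alphaMat r Δ q.1 q.2 * cplxMat g Δ * -(J (Fin g) ℝ * (alphaMat r Δ q.1 q.2)ᵀ * J (Fin g) ℝ)

theorem continuous_unitaryPoint (r Δ : ℕ) : Continuous (unitaryPoint (g := g) r Δ) := by
  have : Continuous fun q : Matrix (Fin g) (Fin g) ℝ × Matrix (Fin g) (Fin g) ℝ =>
      alphaMat r Δ q.1 q.2 := by
    unfold alphaMat
    refine Continuous.matrix_fromBlocks ?_ ?_ ?_ ?_ <;> fun_prop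
  unfold unitaryPoint
  fun_prop

/-- Multiplier one gives M⁻¹ = -J Mᵗ J. Hence `unitaryPoint`, a polynomial and so continuous
expression in q, is the conjugate of h_V(i) by M. -/
theorem exists_GUimage_of_mem {r Δ : ℕ} {q : Matrix (Fin g) (Fin g) ℝ × Matrix (Fin g) (Fin g) ℝ}
    (hq : q ∈ unitarySet g r Δ) : ∃ M ∈ GUimage g r Δ ℝ, M.1.1 = alphaMat r Δ q.1 q.2 ∧
      M.1.1 * J (Fin g) ℝ * M.1.1ᵀ = J (Fin g) ℝ ∧
      (M⁻¹).1.1 = -(J (Fin g) ℝ * (alphaMat r Δ q.1 q.2)ᵀ * J (Fin g) ℝ) := by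
  have h1 : q.1 * signMat g r ℝ * q.1ᵀ + (Δ : ℝ) • (q.2 * signMat g r ℝ * q.2ᵀ)
      = ((1 : ℝˣ) : ℝ) • signMat g r ℝ := by
    rw [hq.1, Units.val_one, one_smul]
  obtain ⟨M, hM, hMq⟩ := GUimage_of_isGU (h := q.1) (k := q.2) ⟨⟨1, h1⟩, hq.2⟩
  have hJ := alphaMat_mul_J_mul_transpose r Δ h1 hq.2
  rw [Units.val_one, one_smul, ← hMq] at hJ
  refine ⟨M, hM, hMq, hJ, ?_⟩
  have h2 : M.1.1 * -(J (Fin g) ℝ * M.1.1ᵀ * J (Fin g) ℝ) = 1 := by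
    rw [Matrix.mul_neg, ← Matrix.mul_assoc, ← Matrix.mul_assoc, hJ, J_squared, neg_neg]
  rw [← hMq, ← Matrix.mul_one (M⁻¹).1.1, ← h2, ← Matrix.mul_assoc, GSp.val_inv_mul,
    Matrix.one_mul]

theorem one_mem_unitarySet (r Δ : ℕ) : ((1, 0) : _ × _) ∈ unitarySet g r Δ := by
  simp [unitarySet]

theorem alphaMat_mul_alphaMat {R : Type*} [CommRing R] (r Δ : ℕ)
    (h k b : Matrix (Fin g) (Fin g) R) :
    alphaMat r Δ (h * b) (k * b) = alphaMat r Δ h k * alphaMat r Δ b 0 := by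
  simp [alphaMat, fromBlocks_multiply, Matrix.mul_assoc]

theorem mul_boost_mem_unitarySet {r Δ : ℕ} {i j : Fin g} (hi : (i : ℕ) < r) (hj : r ≤ (j : ℕ))
    {q : Matrix (Fin g) (Fin g) ℝ × Matrix (Fin g) (Fin g) ℝ} (hq : q ∈ unitarySet g r Δ) (t : ℝ) :
    (q.1 * boost i j t, q.2 * boost i j t) ∈ unitarySet g r Δ := by
  have hij : i ≠ j := by rintro rfl; omega
  have h : boost i j t * (signMat g r ℝ * (boost i j t)ᵀ) = signMat g r ℝ := by
    rw [boost_transpose, signMat_mul_boost hi hj, ← Matrix.mul_assoc, boost_mul_boost hij,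
      add_neg_cancel, boost_zero, Matrix.one_mul]
  have h' : ∀ X Y : Matrix (Fin g) (Fin g) ℝ,
      X * boost i j t * signMat g r ℝ * (Y * boost i j t)ᵀ = X * signMat g r ℝ * Yᵀ := by
    intro X Y
    conv_rhs => rw [← h]
    simp only [transpose_mul, Matrix.mul_assoc]
  exact ⟨by simpa only [h'] using hq.1, by simpa only [h'] using hq.2⟩

theorem unitaryPoint_eq {r Δ : ℕ} {q : Matrix (Fin g) (Fin g) ℝ × Matrix (Fin g) (Fin g) ℝ}
    {M : GSp g ℝ} (hMq : M.1.1 = alphaMat r Δ q.1 q.2)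
    (hM : (M⁻¹).1.1 = -(J (Fin g) ℝ * (alphaMat r Δ q.1 q.2)ᵀ * J (Fin g) ℝ)) :
    unitaryPoint r Δ q = M.1.1 * cplxMat g Δ * (M⁻¹).1.1 := by
  rw [unitaryPoint, hMq, hM]

/-- As E b(t) E = b(-t), the boost is embedded as diag(b(t), b(-t)); conjugating h_V(i) by it
doubles the parameter. -/
theorem unitaryPoint_mul_boost {r Δ : ℕ} {i j : Fin g} (hi : (i : ℕ) < r) (hj : r ≤ (j : ℕ))
    {q : Matrix (Fin g) (Fin g) ℝ × Matrix (Fin g) (Fin g) ℝ}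
    {M : GSp g ℝ} (hMq : M.1.1 = alphaMat r Δ q.1 q.2)
    (hM : (M⁻¹).1.1 = -(J (Fin g) ℝ * (alphaMat r Δ q.1 q.2)ᵀ * J (Fin g) ℝ)) (t : ℝ) :
    unitaryPoint r Δ (q.1 * boost i j t, q.2 * boost i j t) = M.1.1 * fromBlocks 0
      ((√(Δ : ℝ))⁻¹ • boost i j (t + t)) (-(√(Δ : ℝ) • boost i j (-(t + t)))) 0 * (M⁻¹).1.1 := by
  have hij : i ≠ j := by rintro rfl; omega
  have hb : alphaMat r Δ (boost i j t) 0 = fromBlocks (boost i j t) 0 0 (boost i j (-t)) := by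
    simp only [alphaMat, Matrix.zero_mul, Matrix.mul_zero, smul_zero, neg_zero]
    rw [signMat_mul_boost hi hj, Matrix.mul_assoc, signMat_mul_self, Matrix.mul_one]
  have hbJ : -(J (Fin g) ℝ * (fromBlocks (boost i j t) 0 0 (boost i j (-t)))ᵀ * J (Fin g) ℝ)
      = fromBlocks (boost i j (-t)) 0 0 (boost i j t) := by
    rw [J, fromBlocks_transpose, fromBlocks_multiply, fromBlocks_multiply, fromBlocks_neg]
    simp [boost_transpose]
  have hbc : fromBlocks (boost i j t) 0 0 (boost i j (-t)) * cplxMat g Δ *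
      fromBlocks (boost i j (-t)) 0 0 (boost i j t) = fromBlocks 0
      ((√(Δ : ℝ))⁻¹ • boost i j (t + t)) (-(√(Δ : ℝ) • boost i j (-(t + t)))) 0 := by
    rw [cplxMat, fromBlocks_multiply, fromBlocks_multiply]
    simp [boost_mul_boost hij]
  rw [← hbc, ← hbJ, hM, unitaryPoint]
  simp only
  rw [alphaMat_mul_alphaMat, hb, hMq]
  have hJJ : ∀ X : Matrix (Fin g ⊕ Fin g) (Fin g ⊕ Fin g) ℝ,
      J (Fin g) ℝ * (J (Fin g) ℝ * X) = -X := by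
    intro X
    rw [← Matrix.mul_assoc, J_squared, Matrix.neg_mul, Matrix.one_mul]
  simp only [transpose_mul, Matrix.mul_assoc, Matrix.mul_neg, Matrix.neg_mul, hJJ, neg_neg]

/-- For a similitude, M⁻¹J is a multiple of JMᵗ, so the conjugate of X times J is a multiple of M
(XJ) Mᵗ. -/
theorem isSymm_conj_mul_J {R : Type*} [CommRing R] {M : GSp g R}
    {X : Matrix (Fin g ⊕ Fin g) (Fin g ⊕ Fin g) R} (hX : (X * J (Fin g) R).IsSymm) :
    (M.1.1 * X * (M⁻¹).1.1 * J (Fin g) R).IsSymm := by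
  obtain ⟨c, hc⟩ := (M⁻¹).2
  have h := GSp.val_inv_mul M
  have h' : ((M⁻¹).1.1)ᵀ * (M.1.1)ᵀ = 1 := by
    rw [← transpose_mul, GSp.val_mul_inv, transpose_one]
  have h1 : (M⁻¹).1.1 * J (Fin g) R = (c : R) • (J (Fin g) R * (M.1.1)ᵀ) := by
    have := congrArg (· * (M.1.1)ᵀ) hc
    change (M⁻¹).1.1 * J (Fin g) R * ((M⁻¹).1.1)ᵀ * (M.1.1)ᵀ = _ at this
    rw [Matrix.mul_assoc, h', Matrix.mul_one] at this
    rw [this, Matrix.smul_mul]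
  rw [Matrix.mul_assoc, h1, Matrix.mul_smul]
  refine IsSymm.smul ?_ _
  rw [Matrix.mul_assoc, ← Matrix.mul_assoc X]
  simp only [IsSymm, transpose_mul, transpose_transpose] at hX ⊢
  rw [hX, Matrix.mul_assoc]

theorem sqrtMat_mul_J_isSymm {R : Type*} [CommRing R] (r Δ : ℕ) :
    (sqrtMat g r Δ R * J (Fin g) R).IsSymm := by
  rw [sqrtMat_mul_J]
  simp [IsSymm, fromBlocks_transpose]

theorem exists_sign_of_real {r Δ : ℕ} {γ : GSp g ℚ} {e : ℤˣ}
    (h : (GSp.map (algebraMap ℚ ℝ) γ).1.1 * sqrtMat g r Δ ℝ =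
      (e : ℤ) • (sqrtMat g r Δ ℝ * (GSp.map (algebraMap ℚ ℝ) γ).1.1)) :
    γ.1.1 * sqrtMat g r Δ ℚ = (e : ℤ) • (sqrtMat g r Δ ℚ * γ.1.1) := by
  apply Matrix.map_injective (algebraMap ℚ ℝ).injective
  simp only [map_zsmul_matrix, Matrix.map_mul, sqrtMat_map]
  exact h

/-- The interior of the set of points of the unitary group whose complex structure commutes with a
conjugate `X ≠ ±√-Δ` of `√-Δ` is empty. -/
theorem conj_sqrtMat_eq_of_interior {r Δ : ℕ} (hΔ : 0 < Δ) (hr : 0 < r) (hrg : r < g) (G : GSp g ℝ)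
    (h : (interior {q : unitarySet g r Δ | G.1.1 * sqrtMat g r Δ ℝ * (G⁻¹).1.1 *
      unitaryPoint r Δ q = unitaryPoint r Δ q * (G.1.1 * sqrtMat g r Δ ℝ * (G⁻¹).1.1)}).Nonempty) :
    ∃ e : ℤˣ, G.1.1 * sqrtMat g r Δ ℝ = (e : ℤ) • (sqrtMat g r Δ ℝ * G.1.1) := by
  obtain ⟨q, hq⟩ := h
  set X := G.1.1 * sqrtMat g r Δ ℝ * (G⁻¹).1.1 with hX
  set Z := {q : unitarySet g r Δ | X * unitaryPoint r Δ q = unitaryPoint r Δ q * X} with hZ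
  obtain ⟨M, hMU, hMq, -, hMinv⟩ := exists_GUimage_of_mem q.2
  have hqZ : q ∈ Z := interior_subset hq
  -- Conjugation by M⁻¹ moves the base point q to h_V(i), where the boosts have explicit matrices.
  have hX' : ∃ e : ℤˣ, (M⁻¹).1.1 * X * M.1.1 = (e : ℤ) • sqrtMat g r Δ ℝ := by
    have hMG : (M⁻¹).1.1 * X * M.1.1 = (M⁻¹ * G).1.1 * sqrtMat g r Δ ℝ * ((M⁻¹ * G)⁻¹).1.1 := by
      rw [_root_.mul_inv_rev, inv_inv, GSp.val_mul, GSp.val_mul, hX]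
      simp only [Matrix.mul_assoc]
    refine eq_sqrtMat_of_comm hΔ hr hrg ?_ ?_ ?_ ?_
    · rw [hMG]
      have : ∀ (N : GSp g ℝ) (Y : Matrix (Fin g ⊕ Fin g) (Fin g ⊕ Fin g) ℝ),
          N.1.1 * Y * (N⁻¹).1.1 * (N.1.1 * Y * (N⁻¹).1.1) = N.1.1 * (Y * Y) * (N⁻¹).1.1 := by
        intro N Y
        rw [Matrix.mul_assoc _ (N⁻¹).1.1, ← Matrix.mul_assoc (N⁻¹).1.1,
          ← Matrix.mul_assoc (N⁻¹).1.1,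
          GSp.val_inv_mul, Matrix.one_mul]
        simp only [Matrix.mul_assoc]
      rw [this, sqrtMat_mul_self, Matrix.mul_neg, Matrix.neg_mul, Matrix.mul_smul, Matrix.mul_one,
        Matrix.smul_mul, GSp.val_mul_inv]
    · rw [hMG]
      exact isSymm_conj_mul_J (sqrtMat_mul_J_isSymm r Δ)
    · rw [← GSp.conj_comm, ← unitaryPoint_eq hMq hMinv]
      exact hqZ
    · intro i j hi hj
      let f : ℝ → unitarySet g r Δ := fun t => ⟨_, mul_boost_mem_unitarySet hi hj q.2 t⟩
      have hf : Continuous f := by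
        have := continuous_boost i j
        refine Continuous.subtype_mk ?_ _
        fun_prop
      have hf0 : f 0 = q := by
        apply Subtype.ext
        simp only [f, boost_zero, Matrix.mul_one]
      have hnhds : f ⁻¹' Z ∈ nhds (0 : ℝ) :=
        hf.continuousAt.preimage_mem_nhds (by rw [hf0]; exact mem_interior_iff_mem_nhds.1 hq)
      obtain ⟨ε, hε, hball⟩ := Metric.mem_nhds_iff.1 hnhds
      have hfZ : ∀ t : ℝ, |t| < ε → (M⁻¹).1.1 * X * M.1.1 *
          fromBlocks 0 ((√(Δ : ℝ))⁻¹ • boost i j (t + t)) (-(√(Δ : ℝ) • boost i j (-(t + t)))) 0 =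
          fromBlocks 0 ((√(Δ : ℝ))⁻¹ • boost i j (t + t)) (-(√(Δ : ℝ) • boost i j (-(t + t)))) 0 *
          ((M⁻¹).1.1 * X * M.1.1) := by
        intro t ht
        have h1 : f t ∈ Z := hball (by simpa using ht)
        rw [← GSp.conj_comm, ← unitaryPoint_mul_boost hi hj hMq hMinv]
        exact h1
      -- The curve stays in Z for |t| < ε; the doubled parameter of the boost reaches ±ε at t =
      -- ±ε/2.
      refine ⟨ε, hε.ne', ?_⟩
      rintro s (rfl | rfl)
      · have := hfZ (s / 2) (by rw [abs_of_pos (by positivity)]; linarith)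
        rwa [add_halves] at this
      · have := hfZ (-ε / 2) (by rw [neg_div, abs_neg, abs_of_pos (by positivity)]; linarith)
        rwa [add_halves] at this
  obtain ⟨e, he⟩ := hX'
  refine ⟨e, ?_⟩
  have h1 : X = (e : ℤ) • sqrtMat g r Δ ℝ := by
    have := congrArg (fun Y => M.1.1 * Y * (M⁻¹).1.1) he
    simp only [Matrix.mul_assoc, GSp.val_mul_inv, Matrix.mul_one] at this
    rw [← Matrix.mul_assoc, GSp.val_mul_inv, Matrix.one_mul, Matrix.smul_mul, Matrix.mul_smul,
      ← Matrix.mul_assoc, GUimage_comm_sqrtMat hMU, Matrix.mul_assoc, GSp.val_mul_inv,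
      Matrix.mul_one] at this
    exact this
  rw [← Matrix.smul_mul, ← h1, hX, Matrix.mul_assoc, GSp.val_inv_mul, Matrix.mul_one]

/-- In the definite case E = ±1, so √-Δ is a real multiple of h_V(i). The unitary domain is then a
single point and the Baire argument is not needed. -/
theorem exists_smul_cplxMat {r Δ : ℕ} (hΔ : 0 < Δ) (hr : r ≤ g) (h : ¬ (0 < r ∧ r < g)) :
    ∃ d : ℝ, d ≠ 0 ∧ sqrtMat g r Δ ℝ = d • cplxMat g Δ := by
  obtain ⟨e, he0, he⟩ : ∃ e : ℝ, e ≠ 0 ∧ signMat g r ℝ = e • 1 := by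
    rcases Nat.eq_zero_or_pos r with rfl | hr0
    · refine ⟨-1, by norm_num, ?_⟩
      rw [signMat, smul_one_eq_diagonal]
      simp
    · refine ⟨1, one_ne_zero, ?_⟩
      have : r = g := by omega
      subst this
      rw [signMat, smul_one_eq_diagonal]
      simp
  have hδ : √(Δ : ℝ) ≠ 0 := by positivity
  have hδ2 : √(Δ : ℝ) * √(Δ : ℝ) = Δ := Real.mul_self_sqrt (by positivity)
  refine ⟨e * √(Δ : ℝ), mul_ne_zero he0 hδ, ?_⟩
  rw [sqrtMat_eq, cplxMat, he, fromBlocks_smul, smul_neg, smul_smul, smul_smul, smul_smul,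
    mul_assoc, mul_assoc, mul_inv_cancel₀ hδ, hδ2, mul_one, smul_zero, mul_comm]

/-- A generic point of the symmetric domain of the unitary group. -/
theorem exists_generic (r Δ : ℕ) (hr : r ≤ g) (hΔ : 0 < Δ) :
    ∃ x : siegelDomain g, (x : Matrix _ _ ℝ) ∈ unitaryDomain g r Δ ∧ ∀ γ : GSp g ℚ,
      (GSp.map (algebraMap ℚ ℝ) γ⁻¹).1.1 * x * (GSp.map (algebraMap ℚ ℝ) γ).1.1
        ∈ unitaryDomain g r Δ →
      ∃ e : ℤˣ, γ.1.1 * sqrtMat g r Δ ℚ = (e : ℤ) • (sqrtMat g r Δ ℚ * γ.1.1) := by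
  by_contra! hcon
  have hpt : ∀ q : unitarySet g r Δ, unitaryPoint r Δ q ∈ unitaryDomain g r Δ := by
    intro q
    obtain ⟨M, hMU, hMq, -, hMinv⟩ := exists_GUimage_of_mem q.2
    exact mem_unitaryDomain.2 ⟨M, hMU, unitaryPoint_eq hMq hMinv⟩
  by_cases hrs : 0 < r ∧ r < g
  · let Bad := {γ : GSp g ℚ // ∀ e : ℤˣ,
      γ.1.1 * sqrtMat g r Δ ℚ ≠ (e : ℤ) • (sqrtMat g r Δ ℚ * γ.1.1)}
    have : Countable (Matrix (Fin g ⊕ Fin g) (Fin g ⊕ Fin g) ℚ) :=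
      inferInstanceAs (Countable (Fin g ⊕ Fin g → Fin g ⊕ Fin g → ℚ))
    have : Countable Bad := by
      refine Function.Injective.countable (f := fun γ : Bad => γ.1.1.1) ?_
      intro a b hab
      exact Subtype.ext (GSp.ext_val hab)
    let X : Bad → Matrix (Fin g ⊕ Fin g) (Fin g ⊕ Fin g) ℝ := fun γ =>
      (GSp.map (algebraMap ℚ ℝ) γ.1).1.1 * sqrtMat g r Δ ℝ *
        ((GSp.map (algebraMap ℚ ℝ) γ.1)⁻¹).1.1
    have : Nonempty (unitarySet g r Δ) := ⟨⟨_, one_mem_unitarySet r Δ⟩⟩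
    have hclosed : ∀ γ : Bad, IsClosed {q : unitarySet g r Δ |
        X γ * unitaryPoint r Δ q = unitaryPoint r Δ q * X γ} := by
      intro γ
      have h1 : Continuous fun q : unitarySet g r Δ => unitaryPoint r Δ q.1 := by
        have := continuous_unitaryPoint (g := g) r Δ
        fun_prop
      exact isClosed_eq (by fun_prop) (by fun_prop)
    -- If no point were generic, countably many closed sets, one for each bad γ, would cover the
    -- unitary group; one of them would have interior, which makes its γ good.
    have hcover : ⋃ γ : Bad, {q : unitarySet g r Δ |
        X γ * unitaryPoint r Δ q = unitaryPoint r Δ q * X γ} = Set.univ := by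
      refine Set.eq_univ_of_forall fun q => ?_
      obtain ⟨γ, h1, h2⟩ := hcon ⟨_, unitaryDomain_subset hΔ r (hpt q)⟩ (hpt q)
      refine Set.mem_iUnion.2 ⟨⟨γ, h2⟩, ?_⟩
      have h3 := unitaryDomain_comm h1
      rw [map_inv] at h3
      exact ((GSp.conj_comm (M := GSp.map (algebraMap ℚ ℝ) γ) (Y := sqrtMat g r Δ ℝ)).2 h3).symm
    obtain ⟨γ, hγ⟩ := nonempty_interior_of_iUnion_of_closed hclosed hcover
    obtain ⟨e, he⟩ := conj_sqrtMat_eq_of_interior hΔ hrs.1 hrs.2 _ hγ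
    exact γ.2 e (exists_sign_of_real he)
  · obtain ⟨d, hd0, hd⟩ := exists_smul_cplxMat hΔ hr hrs
    have hone : ∀ x ∈ unitaryDomain g r Δ, x = cplxMat g Δ := by
      intro x hx
      obtain ⟨M, hM, rfl⟩ := mem_unitaryDomain.1 hx
      have h1 := GUimage_comm_sqrtMat hM
      rw [hd, Matrix.mul_smul, Matrix.smul_mul] at h1
      rw [smul_right_injective _ hd0 h1, Matrix.mul_assoc, GSp.val_mul_inv, Matrix.mul_one]
    have hx := hpt ⟨_, one_mem_unitarySet r Δ⟩
    obtain ⟨γ, h1, h2⟩ := hcon ⟨_, unitaryDomain_subset hΔ r hx⟩ hx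
    refine h2 1 (exists_sign_of_real ?_)
    have h3 := hone _ h1
    simp only [hone _ hx] at h3
    have h4 := congrArg (fun Y => (GSp.map (algebraMap ℚ ℝ) γ).1.1 * Y) h3
    simp only [map_inv, ← Matrix.mul_assoc, GSp.val_mul_inv, Matrix.one_mul] at h4
    rw [hd, Matrix.mul_smul, Matrix.smul_mul, ← h4]
    simp

end Baire

/-! ### Invariance of T modulo p under linear and antilinear maps -/

section LocalInvariant

variable {g : ℕ} {p : Nat.Primes}

theorem padic_map_injective {m n : Type*} :
    Function.Injective fun M : Matrix m n ℤ_[p] => M.map (algebraMap ℤ_[p] ℚ_[p]) :=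
  Matrix.map_injective (IsFractionRing.injective ℤ_[p] ℚ_[p])

/-- The reduction modulo `p` of `T(σ)` is, up to scalars and congruence, invariant under elements
of `GSp_{2g}(ℤ_p)` that are linear or antilinear over `K`. -/
theorem exists_TMatMod_eq {r Δ : ℕ} {S₁ S₂ : Matrix (Fin g) (Fin g) ℤ} (h₁ : S₁.IsSymm)
    (h₂ : S₂.IsSymm) {m w : GSp g ℚ_[p]} (hm : m ∈ GSpInt g p) (hw : w ∈ GSpInt g p) {e : ℤˣ}
    (hwI : w.1.1 * sqrtMat g r Δ ℚ_[p] = (e : ℤ) • (sqrtMat g r Δ ℚ_[p] * w.1.1))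
    (h : m * sigma p S₂ h₂ = sigma p S₁ h₁ * w) :
    ∃ (P : Matrix (Fin g) (Fin g) (ZMod p)) (c : ZMod p), IsUnit c ∧
      P * TMatMod r Δ p S₂ * Pᵀ = c • TMatMod r Δ p S₁ := by
  obtain ⟨m, rfl⟩ := hm
  obtain ⟨w, rfl⟩ := hw
  have hwI' : w.1.1 * sqrtMat g r Δ ℤ_[p] = (e : ℤ) • (sqrtMat g r Δ ℤ_[p] * w.1.1) := by
    apply padic_map_injective
    simp only [map_zsmul_matrix]
    rw [Matrix.map_mul, Matrix.map_mul, sqrtMat_map, ← GSp.val_map, hwI]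
  have h' := congrArg (fun x => x.1.1) h
  simp only [GSp.val_mul, sigma_val, GSp.val_map, ← Matrix.map_mul] at h'
  have h'' := congrArg (fun X => X.map (PadicInt.toZMod (p := p))) (padic_map_injective h')
  have hred : ∀ S : Matrix (Fin g) (Fin g) ℤ,
      (fromBlocks (1 : Matrix (Fin g) (Fin g) ℤ_[p]) (S.map (Int.cast : ℤ → ℤ_[p])) 0
        (((p : ℕ) : ℤ_[p]) • (1 : Matrix (Fin g) (Fin g) ℤ_[p]))).map
        (PadicInt.toZMod (p := p)) =
      fromBlocks (1 : Matrix (Fin g) (Fin g) (ZMod p)) (S.map (Int.cast : ℤ → ZMod p)) 0 0 := by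
    intro S
    rw [fromBlocks_map, Matrix.map_one _ (map_zero _) (map_one _), Matrix.map_zero _ (map_zero _)]
    congr 1
    · ext; simp
    · ext i j
      simp only [Matrix.map_apply, Matrix.smul_apply, one_apply]
      split_ifs <;> simp
  simp only [Matrix.map_mul, hred] at h''
  obtain ⟨a, b, a', b', hM⟩ : ∃ a b a' b', m.1.1.map (PadicInt.toZMod (p := p))
      = fromBlocks a b a' b' := ⟨_, _, _, _, (fromBlocks_toBlocks _).symm⟩
  obtain ⟨x, y, x', y', hW⟩ : ∃ x y x' y', w.1.1.map (PadicInt.toZMod (p := p))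
      = fromBlocks x y x' y' := ⟨_, _, _, _, (fromBlocks_toBlocks _).symm⟩
  have hgraph : graphMat (S₁.map (Int.cast : ℤ → ZMod p)) * w.1.1.map (PadicInt.toZMod (p := p))
      = a * graphMat (S₂.map (Int.cast : ℤ → ZMod p)) := by
    rw [hM, hW, fromBlocks_multiply, fromBlocks_multiply, fromBlocks_inj] at h''
    rw [hW, graphMat, graphMat, fromCols_mul_fromBlocks, mul_fromCols, ← h''.1, ← h''.2.1]
    simp
  obtain ⟨w, c, hc⟩ := w
  change w.1 * _ * w.1ᵀ = _ at hc
  change w.1 * _ = _ • (_ * w.1) at hwI'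
  change graphMat _ * w.1.map _ = _ at hgraph
  -- Moving w past √-Δ costs the sign e and w scales J by c, so it scales the symmetric form by ec.
  have hcI : w.1 * (sqrtMat g r Δ ℤ_[p] * J (Fin g) ℤ_[p]) * w.1ᵀ =
      ((e : ℤ) * c : ℤ_[p]) • (sqrtMat g r Δ ℤ_[p] * J (Fin g) ℤ_[p]) := by
    rw [← Matrix.mul_assoc, hwI', Matrix.smul_mul, Matrix.smul_mul, Matrix.mul_assoc _ w.1,
      Matrix.mul_assoc, hc, Matrix.mul_smul, ← Int.cast_smul_eq_zsmul ℤ_[p], smul_smul]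
  have hcI' := congrArg (fun X => X.map (PadicInt.toZMod (p := p))) hcI
  have hs : ∀ (t : ℤ_[p]) (X : Matrix (Fin g ⊕ Fin g) (Fin g ⊕ Fin g) ℤ_[p]),
      (t • X).map (PadicInt.toZMod (p := p)) =
        PadicInt.toZMod t • X.map (PadicInt.toZMod (p := p)) := by
    intro t X
    ext; simp
  simp only [hs, Matrix.map_mul, sqrtMat_map, map_J, transpose_map] at hcI'
  refine ⟨a, PadicInt.toZMod ((e : ℤ) * c : ℤ_[p]), ?_, ?_⟩
  · have : IsUnit ((e : ℤ) : ℤ_[p]) := e.isUnit.map (Int.castRingHom ℤ_[p])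
    exact (this.mul c.isUnit).map _
  · rw [TMatMod_eq, TMatMod_eq, ← hermMat_eq r Δ (h₁.map _), ← hermMat_eq r Δ (h₂.map _)]
    have : ∀ (X : Matrix (Fin g) (Fin g ⊕ Fin g) (ZMod p))
        (Y : Matrix (Fin g ⊕ Fin g) (Fin g ⊕ Fin g) (ZMod p)),
        a * (X * Y * Xᵀ) * aᵀ = (a * X) * Y * (a * X)ᵀ := by
      intro X Y
      simp only [transpose_mul, Matrix.mul_assoc]
    rw [this, ← hgraph, ← Matrix.smul_mul, ← Matrix.mul_smul, ← hcI']
    simp only [transpose_mul, Matrix.mul_assoc]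

end LocalInvariant

/-! ### From Shimura subvarieties to cosets at p, and back -/

section Global

variable {g : ℕ} {p : Nat.Primes}

theorem atPlace_same (x : GSp g ℚ_[p]) : atPlace p x p = x := by
  classical
  exact RestrictedProduct.mulSingle_eq_same (GSpInt g) p x

theorem atPlace_ne {l : Nat.Primes} (h : l ≠ p) (x : GSp g ℚ_[p]) : atPlace p x l = 1 := by
  classical
  exact RestrictedProduct.mulSingle_eq_of_ne (GSpInt g) x h

theorem atPlace_mul (x y : GSp g ℚ_[p]) : atPlace p (x * y) = atPlace p x * atPlace p y := by
  classical
  exact RestrictedProduct.mulSingle_mul (GSpInt g) p x y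

theorem atPlace_one : atPlace p (1 : GSp g ℚ_[p]) = 1 := by
  classical
  exact RestrictedProduct.mulSingle_one (GSpInt g) p

theorem exists_sigma_eq (S : Matrix (Fin g) (Fin g) ℤ) (hS : S.IsSymm) :
    ∃ b ∈ GSpInt g p, sigma p S hS = tau g p * b := by
  obtain ⟨u, hu⟩ : ∃ u : GSp g ℤ_[p], u.1.1 = fromBlocks 1 (S.map (Int.cast : ℤ → ℤ_[p])) 0 1 := by
    refine GSp.exists_val_eq isUnit_one ?_
    rw [J, fromBlocks_transpose, fromBlocks_multiply, fromBlocks_multiply, fromBlocks_smul]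
    congr 1 <;> simp [(hS.map (Int.cast : ℤ → ℤ_[p])).eq]
  refine ⟨_, ⟨u, rfl⟩, GSp.ext_val ?_⟩
  rw [tau, GSp.val_mul, sigma_val, sigma_val, GSp.val_map, hu, ← Matrix.map_mul,
    fromBlocks_multiply]
  simp

theorem sigma_mem_heckeCoset (S : Matrix (Fin g) (Fin g) ℤ) (hS : S.IsSymm) :
    sigma p S hS ∈ heckeCoset g p := by
  obtain ⟨b, hb, h⟩ := exists_sigma_eq (p := p) S hS
  exact ⟨1, one_mem _, b, hb, by rw [h, one_mul]⟩

variable {𝒦 : Subgroup (GSpAf g)}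

theorem exists_represents (hlevel : LevelPrimeTo 𝒦 p) (S : Matrix (Fin g) (Fin g) ℤ)
    (hS : S.IsSymm) : ∃ c, Represents 𝒦 p (sigma p S hS) c := by
  obtain ⟨b, hb, h⟩ := exists_sigma_eq (p := p) S hS
  exact ⟨atPlace p b, hlevel.2 b hb, 1, one_mem _, by rw [h, atPlace_mul, one_mul]⟩

/-- The components of elements in the same orbit of the unitary group lie in the same Shimura
subvariety. -/
theorem dEquiv_of_unitary {r Δ : ℕ} (hlevel : LevelPrimeTo 𝒦 p)
    {S₁ S₂ : Matrix (Fin g) (Fin g) ℤ} (h₁ : S₁.IsSymm) (h₂ : S₂.IsSymm) {u m : GSp g ℚ_[p]}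
    (hu : u ∈ GSpInt g p) (huV : u ∈ GUimage g r Δ ℚ_[p]) (hm : m ∈ GSpInt g p)
    (h : sigma p S₁ h₁ * u = m * sigma p S₂ h₂) :
    DEquiv r Δ 𝒦 p (sigma p S₁ h₁) (sigma p S₂ h₂) := by
  refine ⟨sigma p S₁ h₁, sigma_mem_heckeCoset S₁ h₁, ?_, ?_⟩
  · rintro P ⟨x, hx, c, hc, rfl⟩
    exact ⟨x, hx, c, hc, 1, fun l => one_mem_GUimage r Δ, by rw [mul_one]⟩
  · rintro P ⟨x, hx, c, ⟨hcK, k, hk, hc⟩, rfl⟩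
    have hinv : atPlace p u * atPlace p u⁻¹ = 1 := by
      rw [← atPlace_mul, mul_inv_cancel, atPlace_one]
    have hinv' : atPlace p u⁻¹ * atPlace p u = 1 := by
      rw [← atPlace_mul, inv_mul_cancel, atPlace_one]
    -- [x, c] = [x, (c u⁻¹) u], and c u⁻¹ represents σ(S₁) because σ(S₁) = m σ(S₂) u⁻¹.
    refine ⟨x, hx, c * atPlace p u⁻¹, ⟨?_, atPlace p m * k, ?_, ?_⟩, atPlace p u, fun l => ?_, ?_⟩
    · exact mul_mem hcK (hlevel.2 _ (inv_mem hu))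
    · exact mul_mem (hlevel.2 _ hm) hk
    · rw [eq_mul_inv_of_mul_eq h, atPlace_mul, atPlace_mul, hc]
      simp only [mul_assoc]
    · by_cases hl : l = p
      · subst hl
        rwa [atPlace_same]
      · rw [atPlace_ne hl]
        exact one_mem_GUimage r Δ
    · rw [mul_assoc, hinv', mul_one]

/-- At a generic x, an equality [x, c] = [y, c'u] comes from k ∈ 𝒦_p and a rational γ that is linear
or antilinear. At p, w = c⁻¹k⁻¹c' = γu⁻¹: the first expression shows that w is integral, the second
that it is linear or antilinear. -/
theorem exists_antilinear_of_subset {r Δ : ℕ} (hr : r ≤ g) (hΔ : 0 < Δ)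
    (hlevel : LevelPrimeTo 𝒦 p)
    {S : Matrix (Fin g) (Fin g) ℤ} (hS : S.IsSymm) {σ : GSp g ℚ_[p]}
    (h : componentOf r Δ 𝒦 p (sigma p S hS) ⊆ shimuraSubvarietyOf r Δ 𝒦 p σ) :
    ∃ m ∈ GSpInt g p, ∃ w ∈ GSpInt g p, σ = m * sigma p S hS * w ∧
      ∃ e : ℤˣ, w.1.1 * sqrtMat g r Δ ℚ_[p] = (e : ℤ) • (sqrtMat g r Δ ℚ_[p] * w.1.1) := by
  obtain ⟨x, hx, hgen⟩ := exists_generic r Δ hr hΔ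
  obtain ⟨c, hc⟩ := exists_represents hlevel S hS
  obtain ⟨y, hy, c', hc', u, hu, heq⟩ := h ⟨x, hx, c, hc, rfl⟩
  obtain ⟨γ, k, hk, h1, h2⟩ := Quotient.exact heq
  simp only at h1 h2
  obtain ⟨e, he⟩ := hgen γ (by rw [← h1]; exact hy)
  obtain ⟨hcK, k₁, hk₁, hc⟩ := hc
  obtain ⟨hcK', k₂, hk₂, hc'⟩ := hc'
  have hp := h2 p
  have hc := congrArg (fun a => a p) hc
  have hc' := congrArg (fun a => a p) hc'
  simp only [RestrictedProduct.mul_apply, atPlace_same] at hc hc' hp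
  have hkp : k p ∈ GSpInt g p := hlevel.1 _ hk.1
  -- The definition of 𝒦_p lets k be moved to the left of τ_p, where it is absorbed into m.
  have hkt : tau g p * k p * (tau g p)⁻¹ ∈ GSpInt g p := by
    have h3 := hlevel.1 _ hk.2
    have h4 : (MulAut.conj (atPlace p (tau g p))).toMonoidHom k p
        = tau g p * k p * (tau g p)⁻¹ := by
      simp [RestrictedProduct.mul_apply, RestrictedProduct.inv_apply, atPlace_same]
    rwa [h4] at h3
  set G := GSp.map (algebraMap ℚ ℚ_[p]) γ with hG
  refine ⟨k₂ p * (tau g p * k p * (tau g p)⁻¹) * (k₁ p)⁻¹,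
    mul_mem (mul_mem (hlevel.1 _ hk₂) hkt) (inv_mem (hlevel.1 _ hk₁)),
    (c p)⁻¹ * (k p)⁻¹ * c' p, mul_mem (mul_mem (inv_mem (hlevel.1 _ hcK)) (inv_mem hkp))
      (hlevel.1 _ hcK'), ?_, e, ?_⟩
  · rw [hc, hc']
    group
  · have hw : (c p)⁻¹ * (k p)⁻¹ * c' p = G * (u p)⁻¹ := by
      rw [eq_mul_inv_of_mul_eq hp]
      group
    have hGI : G.1.1 * sqrtMat g r Δ ℚ_[p] = (e : ℤ) • (sqrtMat g r Δ ℚ_[p] * G.1.1) := by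
      have := congrArg (fun X => X.map (algebraMap ℚ ℚ_[p])) he
      simp only [map_zsmul_matrix, Matrix.map_mul, sqrtMat_map] at this
      exact this
    have huI : ((u p)⁻¹).1.1 * sqrtMat g r Δ ℚ_[p] = sqrtMat g r Δ ℚ_[p] * ((u p)⁻¹).1.1 := by
      have h5 := GUimage_comm_sqrtMat (hu p)
      have h6 := congrArg (fun X => ((u p)⁻¹).1.1 * X * ((u p)⁻¹).1.1) h5
      simp only [← Matrix.mul_assoc, GSp.val_inv_mul, Matrix.one_mul] at h6
      rw [h6, Matrix.mul_assoc, GSp.val_mul_inv, Matrix.mul_one]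
    rw [hw, GSp.val_mul, Matrix.mul_assoc, huI, ← Matrix.mul_assoc, hGI, Matrix.smul_mul,
      Matrix.mul_assoc]

/-- D-equivalent elements have similar matrices `T(σ)` modulo `p`. -/
theorem DEquiv.exists_TMatMod_eq {r Δ : ℕ} (hr : r ≤ g) (hΔ : 0 < Δ)
    (hlevel : LevelPrimeTo 𝒦 p)
    {S₁ S₂ : Matrix (Fin g) (Fin g) ℤ} {h₁ : S₁.IsSymm} {h₂ : S₂.IsSymm}
    (h : DEquiv r Δ 𝒦 p (sigma p S₁ h₁) (sigma p S₂ h₂)) :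
    ∃ (P : Matrix (Fin g) (Fin g) (ZMod p)) (c : ZMod p), IsUnit c ∧
      P * TMatMod r Δ p S₂ * Pᵀ = c • TMatMod r Δ p S₁ := by
  obtain ⟨σ, -, hσ₁, hσ₂⟩ := h
  obtain ⟨m, hm, w, hw, e1, e, he⟩ := exists_antilinear_of_subset hr hΔ hlevel h₁ hσ₁
  obtain ⟨m', hm', w', hw', e1', e', he'⟩ := exists_antilinear_of_subset hr hΔ hlevel h₂ hσ₂
  refine SiegelHecke.exists_TMatMod_eq h₁ h₂ (m := m⁻¹ * m') (w := w * w'⁻¹) (e := e * e')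
    (mul_mem (inv_mem hm) hm') (mul_mem hw (inv_mem hw')) ?_ ?_
  -- The inverse of w' satisfies the same relation with the same sign, as e' is its own inverse.
  · have h6 := congrArg (fun X => (e' : ℤ) • ((w'⁻¹).1.1 * X * (w'⁻¹).1.1)) he'
    have hee : (e' : ℤ) * e' = 1 := by rw [← Units.val_mul, Int.units_mul_self]; rfl
    simp only [← Matrix.mul_assoc, GSp.val_inv_mul, Matrix.one_mul, Matrix.mul_smul,
      Matrix.smul_mul, smul_smul, hee, one_smul] at h6
    rw [Matrix.mul_assoc, GSp.val_mul_inv, Matrix.mul_one] at h6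
    rw [GSp.val_mul, Matrix.mul_assoc, ← h6, Matrix.mul_smul, ← Matrix.mul_assoc, he,
      Matrix.smul_mul, smul_smul, Matrix.mul_assoc, Units.val_mul, mul_comm (e : ℤ)]
  · rw [e1] at e1'
    have h7 : m' * sigma p S₂ h₂ = m * sigma p S₁ h₁ * w * w'⁻¹ := eq_mul_inv_of_mul_eq e1'.symm
    rw [mul_assoc, h7]
    group

end Global

/-! ### Square classes of det T -/

/-- For a non-square `n` of a finite field there is a `t` for which `1 - n t ^ 2` is not a
square. -/
theorem exists_not_isSquare_one_sub {F : Type*} [Field F] [Finite F] {n : F} (hn : ¬ IsSquare n) :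
    ∃ t : F, ¬ IsSquare (1 - n * t ^ 2) := by
  by_contra! hcon
  have hn0 : n ≠ 0 := by rintro rfl; exact hn IsSquare.zero
  -- Otherwise a ↦ 1 - na is an injective map of the finite set of squares to itself, hence
  -- surjective; it attains 0 at some b², and n = b⁻² is a square.
  have hmap : ∀ a : {a : F // IsSquare a}, IsSquare (1 - n * a.1) := by
    rintro ⟨_, b, rfl⟩
    simpa [sq] using hcon b
  have hinj : Function.Injective
      fun a : {a : F // IsSquare a} => (⟨1 - n * a.1, hmap a⟩ : {a : F // IsSquare a}) := by
    intro a b hab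
    have := congrArg Subtype.val hab
    simpa [hn0, Subtype.ext_iff] using this
  obtain ⟨⟨_, b, rfl⟩, hb⟩ := Finite.injective_iff_surjective.1 hinj ⟨0, IsSquare.zero⟩
  have hb' : 1 - n * (b * b) = 0 := congrArg Subtype.val hb
  have hb0 : b ≠ 0 := by rintro rfl; simp at hb'
  refine hn ⟨b⁻¹, ?_⟩
  field_simp
  linear_combination -hb'

theorem not_isSquare_of_legendreSym {p Δ : ℕ} [Fact p.Prime]
    (h : legendreSym p (-(Δ : ℤ)) = -1) : ¬ IsSquare (-(Δ : ZMod p)) := by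
  simpa using (legendreSym.eq_neg_one_iff p).1 h

/-- The determinants of the matrices `T(σ)` modulo `p` take different square classes. -/
theorem exists_det_TMatMod {g : ℕ} (hg : 0 < g) (r : ℕ) {p Δ : ℕ} [Fact p.Prime]
    (h : legendreSym p (-(Δ : ℤ)) = -1) :
    ∃ S : Matrix (Fin g) (Fin g) ℤ, S.IsSymm ∧ IsUnit (TMatMod r Δ p S) ∧
      ¬ IsSquare ((TMatMod r Δ p S).det / (TMatMod r Δ p (0 : Matrix (Fin g) (Fin g) ℤ)).det) := by
  obtain ⟨t, ht⟩ := exists_not_isSquare_one_sub (not_isSquare_of_legendreSym h)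
  obtain ⟨t, rfl⟩ := ZMod.intCast_surjective t
  set i : Fin g := ⟨0, hg⟩
  have h0 : TMatMod r Δ p (0 : Matrix (Fin g) (Fin g) ℤ) = signMat g r (ZMod p) := by
    rw [TMatMod_eq, Matrix.map_zero _ Int.cast_zero]
    simp [hermMat]
  -- For S = diag(t, 0, …, 0) only the first entry of E changes, by the factor 1 + Δt². Its being a
  -- non-square also makes it nonzero.
  have hdet : (TMatMod r Δ p (diagonal (Pi.single i t))).det =
      (1 - -(Δ : ZMod p) * (t : ZMod p) ^ 2) * (signMat g r (ZMod p)).det := by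
    have hS : TMatMod r Δ p (diagonal (Pi.single i t)) =
        diagonal (Function.update 1 i (1 - -(Δ : ZMod p) * (t : ZMod p) ^ 2)) *
          signMat g r (ZMod p) := by
      rw [TMatMod_eq, diagonal_map Int.cast_zero, hermMat, signMat, diagonal_mul_diagonal,
        diagonal_mul_diagonal, diagonal_mul_diagonal, ← diagonal_smul, diagonal_add]
      congr 1
      ext k
      by_cases hk : k = i
      · subst hk
        simp
        split_ifs <;> ring
      · simp [hk]
    rw [hS, det_mul, det_diagonal, Finset.prod_update_of_mem (Finset.mem_univ i)]
    simp
  have hE := (isUnit_det_signMat (g := g) (R := ZMod p) r).ne_zero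
  refine ⟨diagonal (Pi.single i t), isSymm_diagonal _, ?_, ?_⟩
  · rw [isUnit_iff_isUnit_det, hdet, isUnit_iff_ne_zero]
    refine mul_ne_zero ?_ hE
    intro h1
    exact ht (h1 ▸ IsSquare.zero)
  · rwa [h0, hdet, mul_div_cancel_right₀ _ hE]

theorem isUnit_TMatMod_zero (g r Δ p : ℕ) [Fact p.Prime] :
    IsUnit (TMatMod r Δ p (0 : Matrix (Fin g) (Fin g) ℤ)) := by
  rw [TMatMod_eq, Matrix.map_zero _ Int.cast_zero, isUnit_iff_isUnit_det]
  simpa [hermMat] using isUnit_det_signMat (g := g) (R := ZMod p) r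

/-! ### Classification of the generic stratum -/

section Classes

variable {g : ℕ} {p : Nat.Primes} {𝒦 : Subgroup (GSpAf g)} {r Δ : ℕ}

/-- The generic stratum is stable under D-equivalence. -/
theorem DEquiv.isUnit_TMatMod (hr : r ≤ g) (hΔ : 0 < Δ) (hlevel : LevelPrimeTo 𝒦 p)
    {S₁ S₂ : Matrix (Fin g) (Fin g) ℤ} {h₁ : S₁.IsSymm} {h₂ : S₂.IsSymm}
    (h : DEquiv r Δ 𝒦 p (sigma p S₁ h₁) (sigma p S₂ h₂)) (hT : IsUnit (TMatMod r Δ p S₁)) :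
    IsUnit (TMatMod r Δ p S₂) := by
  obtain ⟨P, c, hc, hP⟩ := h.exists_TMatMod_eq hr hΔ hlevel
  have hdet := congrArg Matrix.det hP
  rw [det_smul, det_mul, det_mul] at hdet
  rw [isUnit_iff_isUnit_det] at hT ⊢
  have := (hc.pow (Fintype.card (Fin g))).mul hT
  rw [← hdet] at this
  exact isUnit_of_mul_isUnit_right (isUnit_of_mul_isUnit_left this)

/-- Determinants of P T₂ Pᵗ = c T₁ give (det P)² det T₂ = c^g det T₁, and c^g is a square for even
g. -/
theorem DEquiv.isSquare_det (hg : Even g) (hr : r ≤ g) (hΔ : 0 < Δ) (hlevel : LevelPrimeTo 𝒦 p)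
    {S₁ S₂ : Matrix (Fin g) (Fin g) ℤ} {h₁ : S₁.IsSymm} {h₂ : S₂.IsSymm}
    (h : DEquiv r Δ 𝒦 p (sigma p S₁ h₁) (sigma p S₂ h₂)) (hT : IsUnit (TMatMod r Δ p S₁)) :
    IsSquare ((TMatMod r Δ p S₁).det / (TMatMod r Δ p S₂).det) := by
  have hT₂ := h.isUnit_TMatMod hr hΔ hlevel hT
  obtain ⟨P, c, hc, hP⟩ := h.exists_TMatMod_eq hr hΔ hlevel
  have hdet := congrArg Matrix.det hP
  rw [det_smul, det_mul, det_mul, det_transpose, Fintype.card_fin] at hdet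
  rw [isUnit_iff_isUnit_det, isUnit_iff_ne_zero] at hT₂
  obtain ⟨n, rfl⟩ := hg
  have hc0 := hc.ne_zero
  refine ⟨P.det / c ^ n, ?_⟩
  rw [div_eq_iff hT₂]
  field_simp
  linear_combination -hdet

theorem DEquiv.of_isUnit (hg : 0 < g) (hp2 : (p : ℕ) ≠ 2) (hlevel : LevelPrimeTo 𝒦 p)
    {S₁ S₂ : Matrix (Fin g) (Fin g) ℤ} (h₁ : S₁.IsSymm) (h₂ : S₂.IsSymm)
    (hT₁ : IsUnit (TMatMod r Δ p S₁)) (hT₂ : IsUnit (TMatMod r Δ p S₂))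
    (h : Odd g ∨ IsSquare ((TMatMod r Δ p S₁).det / (TMatMod r Δ p S₂).det)) :
    DEquiv r Δ 𝒦 p (sigma p S₁ h₁) (sigma p S₂ h₂) := by
  obtain ⟨u, hu, huV, m, hm, e⟩ := exists_unitary_of_det hg r Δ hp2 h₁ h₂ hT₁ hT₂ h
  exact dEquiv_of_unitary hlevel h₁ h₂ hu huV hm e

end Classes

end SiegelHecke

end

theorem mainTheorem1 (g r s : ℕ) (hg : 0 < g) (hrs : r + s = g)
    (Δ : ℕ) (hΔ : 0 < Δ) (p : Nat.Primes) (hp2 : (p : ℕ) ≠ 2)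
    (hinert : legendreSym (p : ℕ) (-(Δ : ℤ)) = -1)
    (𝒦 : Subgroup (SiegelHecke.GSpAf g)) (hopen : IsOpen (𝒦 : Set (SiegelHecke.GSpAf g)))
    (hcompact : IsCompact (𝒦 : Set (SiegelHecke.GSpAf g)))
    (hlevel : SiegelHecke.LevelPrimeTo 𝒦 p) :
    -- the generic stratum is the locus where `T(σ)` is invertible modulo `p`
    (∀ S : Matrix (Fin g) (Fin g) ℤ, S.IsSymm →
      (SiegelHecke.InStratum r Δ p (2 * g) S ↔ IsUnit (SiegelHecke.TMatMod r Δ p S))) ∧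
    -- for odd `g` the generic stratum is a single D-equivalence class
    (Odd g →
      (∃ S : Matrix (Fin g) (Fin g) ℤ, S.IsSymm ∧ SiegelHecke.InStratum r Δ p (2 * g) S) ∧
      ∀ (S₁ S₂ : Matrix (Fin g) (Fin g) ℤ) (h₁ : S₁.IsSymm) (h₂ : S₂.IsSymm),
        SiegelHecke.InStratum r Δ p (2 * g) S₁ →
        (SiegelHecke.DEquiv r Δ 𝒦 p (SiegelHecke.sigma p S₁ h₁) (SiegelHecke.sigma p S₂ h₂) ↔
          SiegelHecke.InStratum r Δ p (2 * g) S₂)) ∧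
    -- for even `g` it is a union of two D-equivalence classes, separated by `det T(σ)`
    (Even g →
      (∀ (S₁ S₂ : Matrix (Fin g) (Fin g) ℤ) (h₁ : S₁.IsSymm) (h₂ : S₂.IsSymm),
        SiegelHecke.InStratum r Δ p (2 * g) S₁ → SiegelHecke.InStratum r Δ p (2 * g) S₂ →
        (SiegelHecke.DEquiv r Δ 𝒦 p (SiegelHecke.sigma p S₁ h₁) (SiegelHecke.sigma p S₂ h₂) ↔
          IsSquare ((SiegelHecke.TMatMod r Δ p S₁).det / (SiegelHecke.TMatMod r Δ p S₂).det))) ∧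
      ∃ (S₁ S₂ : Matrix (Fin g) (Fin g) ℤ) (h₁ : S₁.IsSymm) (h₂ : S₂.IsSymm),
        SiegelHecke.InStratum r Δ p (2 * g) S₁ ∧ SiegelHecke.InStratum r Δ p (2 * g) S₂ ∧
        ¬ SiegelHecke.DEquiv r Δ 𝒦 p (SiegelHecke.sigma p S₁ h₁)
            (SiegelHecke.sigma p S₂ h₂)) ∧
    -- no element of the generic stratum is D-equivalent to an element outside it
    (∀ (S₁ S₂ : Matrix (Fin g) (Fin g) ℤ) (h₁ : S₁.IsSymm) (h₂ : S₂.IsSymm),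
      SiegelHecke.InStratum r Δ p (2 * g) S₁ → ¬ SiegelHecke.InStratum r Δ p (2 * g) S₂ →
      ¬ SiegelHecke.DEquiv r Δ 𝒦 p (SiegelHecke.sigma p S₁ h₁)
          (SiegelHecke.sigma p S₂ h₂)) := by
  have hr : r ≤ g := by omega
  refine ⟨fun S _ => SiegelHecke.inStratum_iff S, ?_⟩
  simp only [SiegelHecke.inStratum_iff]
  refine ⟨fun hodd => ⟨⟨0, isSymm_zero, ?_⟩, fun S₁ S₂ h₁ h₂ hT₁ => ?_⟩,
    fun heven => ⟨fun S₁ S₂ h₁ h₂ hT₁ hT₂ => ?_, ?_⟩, fun S₁ S₂ h₁ h₂ hT₁ hT₂ h => ?_⟩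
  · exact SiegelHecke.isUnit_TMatMod_zero g r Δ p
  · exact ⟨fun h => h.isUnit_TMatMod hr hΔ hlevel hT₁,
      fun hT₂ => .of_isUnit hg hp2 hlevel h₁ h₂ hT₁ hT₂ (.inl hodd)⟩
  · exact ⟨fun h => h.isSquare_det heven hr hΔ hlevel hT₁,
      fun h => .of_isUnit hg hp2 hlevel h₁ h₂ hT₁ hT₂ (.inr h)⟩
  · obtain ⟨S, hS, hT, hsq⟩ := SiegelHecke.exists_det_TMatMod hg r hinert
    exact ⟨S, 0, hS, isSymm_zero, hT, SiegelHecke.isUnit_TMatMod_zero g r Δ p,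
      fun h => hsq (h.isSquare_det heven hr hΔ hlevel hT)⟩
  · exact hT₂ (h.isUnit_TMatMod hr hΔ hlevel hT₁)
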